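/- **Theorem (tight width/parallelism bound, with achievability and order-optimality).** Let $d\ge 2$, let $I\subseteq\mathbb{R}$ be an interval with more than one point, let $c>0$, $\rho_{\max}\ge 0$, and let $r:I\to(0,\infty)$ be $C^1$ with $|r'(t)|\le c$ for all $t\in I$. Write $B_{r(t)}=\{x\in\mathbb{R}^d:\|x\|\le r(t)\}$. Call a pair $(\rho,v)$ of functions $\rho:\mathbb{R}^d\times I\to[0,\infty)$, $v:\mathbb{R}^d\times I\to\mathbb{R}^d$ *admissible* if it is of class $C^1$ and, for all $t\in I$, $$\partial_t\rho+\nabla\cdot(\rho v)=0,\qquad \|\rho(\cdot,t)\|_{L^\infty}\le\rho_{\max},\qquad \|v(\cdot,t)\|_{L^\infty}\le c .$$ Put $M_\rho(t)=\int_{B_{r(t)}}\rho(x,t)\,dx$. (Derivatives in $t$ at an endpoint of $I$ are one-sided; asymptotic notation refers to $t\to\infty$.) 1. (Bound.) If $(\rho,v)$ is admissible, then $M_\rho$ is differentiable on $I$ and, for every $t\in I$, $$\Big|\frac{d}{dt}\int_{B_{r(t)}}\rho\Big|\le\rho_{\max}\,(c+|r'(t)|)\,\mathrm{Area}(\partial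 B_{r(t)}).$$ If moreover $I$ is unbounded above and $r(t)=\Theta(t)$, then $\frac{d}{dt}M_\rho(t)=O(t^{d-1})$. 2. (Achievability of the constant.) For every $\varepsilon>0$ and every time $t\in I$ there is an admissible $C^\infty$ pair $(\rho,v)$ (depending on $\varepsilon$ and $t$) with $\|\rho(\cdot,s)\|_{L^\infty}=\rho_{\max}$ and $\|v(\cdot,s)\|_{L^\infty}=c$ for all $s\in I$ such that, at the time $t$, $$\Big|\frac{d}{dt}\int_{B_{r(t)}}\rho\Big|\ge(1-\varepsilon)\,\rho_{\max}\,(c+|r'(t)|)\,\mathrm{Area}(\partial B_{r(t)}).$$ 3. (Order-optimality.) Suppose $\rho_{\max}>0$, $I$ is unbounded above, $r(t)=\Theta(t)$, and $\liminf_{t\to\infty}r'(t)>-c$ (for instance, $r$ is nondecreasing). Then there is an admissible $C^\infty$ pair $(\rho,v)$ with $\big|\frac{d}{dt}\int_{B_{r(t)}}\rho\big|=\Theta(t^{d-1})$. Hence the order $t^{d-1}$ in part 1 is best possible. -/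

import Mathlib

open MeasureTheory Set Filter Asymptotics
open scoped Topology ContDiff

noncomputable section

namespace MovingBall

/-- Euclidean space of dimension `d`. -/
abbrev E (d : ℕ) := EuclideanSpace ℝ (Fin d)

/-- The divergence `∑ i, ∂ᵢ wᵢ` of a vector field on Euclidean space. -/
def divergence {d : ℕ} (w : E d → E d) (x : E d) : ℝ :=
  ∑ i : Fin d, (fderiv ℝ w x (EuclideanSpace.single i 1)) i

/-- The surface measure of the sphere of radius `r` about the origin (as a measure on the ambient
space): the surface measure of the unit sphere is carried over by `u ↦ r • u` and multiplied by
`r ^ (d - 1)`. -/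
def surfaceMeasure (d : ℕ) (r : ℝ) : Measure (E d) :=
  ENNReal.ofReal (r ^ (d - 1)) •
    ((volume : Measure (E d)).toSphere.map (fun u : Metric.sphere (0 : E d) 1 => r • (u : E d)))

/-- The area of the sphere of radius `r` about the origin, i.e. of the boundary of the ball. -/
def sphereArea (d : ℕ) (r : ℝ) : ℝ :=
  (surfaceMeasure d r (Metric.sphere (0 : E d) r)).toReal

/-- The area of a sphere is `d ω_d r ^ (d - 1)`, with `ω_d` the volume of the unit ball. -/
theorem sphereArea_eq (d : ℕ) {r : ℝ} (hr : 0 < r) :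
    sphereArea d r = d * (volume (Metric.ball (0 : E d) 1)).toReal * r ^ (d - 1) := by
  have hm : Measurable (fun u : Metric.sphere (0 : E d) 1 => r • (u : E d)) :=
    (measurable_subtype_coe).const_smul r
  have hpre : (fun u : Metric.sphere (0 : E d) 1 => r • (u : E d)) ⁻¹' Metric.sphere (0 : E d) r
      = univ := by
    ext u
    have h1 : ‖(u : E d)‖ = 1 := by simp
    simp [norm_smul, abs_of_pos hr]
  unfold sphereArea surfaceMeasure
  rw [Measure.smul_apply, Measure.map_apply hm Metric.isClosed_sphere.measurableSet, hpre,
    Measure.toSphere_apply_univ, smul_eq_mul, ENNReal.toReal_mul, ENNReal.toReal_mul,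
    ENNReal.toReal_ofReal (by positivity)]
  simp
  ring

/-- The mass `∫_{B_{r(t)}} ρ(x, t) dx` inside the moving ball at time `t`. -/
def mass {d : ℕ} (r : ℝ → ℝ) (ρ : E d → ℝ → ℝ) (t : ℝ) : ℝ :=
  ∫ x in Metric.closedBall (0 : E d) (r t), ρ x t

/-- `(ρ, v)` is an admissible pair of class `C^k` on `ℝᵈ × I`: `ρ ≥ 0` is a density transported by
the velocity field `v` according to the continuity equation `∂ₜρ + ∇·(ρ v) = 0`, and at every time
`‖ρ(·, t)‖_{L^∞} ≤ ρmax` and `‖v(·, t)‖_{L^∞} ≤ c`. At an endpoint of `I` that belongs to `I` the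
time derivative is one-sided. -/
structure IsAdmissible {d : ℕ} (k : WithTop ℕ∞) (I : Set ℝ) (c ρmax : ℝ)
    (ρ : E d → ℝ → ℝ) (v : E d → ℝ → E d) : Prop where
  contDiffOn_density : ContDiffOn ℝ k (fun p : E d × ℝ => ρ p.1 p.2) (univ ×ˢ I)
  contDiffOn_velocity : ContDiffOn ℝ k (fun p : E d × ℝ => v p.1 p.2) (univ ×ˢ I)
  nonneg : ∀ t ∈ I, ∀ x, 0 ≤ ρ x t
  continuity_eq : ∀ t ∈ I, ∀ x,
    derivWithin (fun s => ρ x s) I t + divergence (fun y => ρ y t • v y t) x = 0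
  density_le : ∀ t ∈ I, eLpNorm (fun x => ρ x t) ⊤ volume ≤ ENNReal.ofReal ρmax
  velocity_le : ∀ t ∈ I, eLpNorm (fun x => v x t) ⊤ volume ≤ ENNReal.ofReal c

end MovingBall

end

noncomputable section

namespace MovingBall

/-! Bound. Rescaling to the unit ball writes the mass as `r ^ d` times an integral over a fixed set.
Differentiating under the integral and inserting the continuity equation gives Reynolds' formula `M'
= ∫_{B_r} ∇·(ρ ((r'/r) x - v))` (`hasDerivWithinAt_mass`). On `B_r` this field has norm at most
`ρmax (c + |r'|)`, so what remains is the flux estimate `|∫_B ∇·w| ≤ sup ‖w‖ · Area`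
(`abs_setIntegral_divergence_le`), proved by integration by parts against radial cutoffs.

Constant. Near equality needs density close to `ρmax` and a radial velocity of size close to `c` on
the sphere, directed against the motion of the boundary. Kept up for long, such a flow would break
the density bound. In `exists_isAdmissible_linear` the flux therefore carries a fast cosine in time
and the density the matching sine: at the chosen time the flux has full strength, while the density
always stays near a constant. A divergence-free shear far away makes both sup norms exact.

Order. One flow must now serve all large times. Pull back a constant density `κ` under `x ↦ (1 +
G(‖x‖²/T²)) x` with `T = √(1 + t²)`. The mass of `B_R` becomes `κ V (R (1 + G))^d`, with `V` the
volume of the unit ball, and `G` is chosen so that `R (1 + G) = R + c' T` once `R ≥ α T`. Eventually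
`M' = κ V d (r + c' T)^(d-1) (r' + c' T')`; since `T' → 1`, the last factor stays positive when `c'
< c` is close enough to `c`. -/

/-! ### Differentiation under the integral sign within an interval -/

theorem uniqueDiffOn_of_ordConnected {I : Set ℝ} (hI : I.OrdConnected) (hI' : I.Nontrivial) :
    UniqueDiffOn ℝ I :=
  uniqueDiffOn_convex hI.convex (hI.convex.nontrivial_iff_nonempty_interior.1 hI')

/-- A `C¹` function on `X × I` is Lipschitz in time at `t`, uniformly on compact subsets of `X`. -/
theorem exists_eventually_forall_abs_sub_le {X : Type*} [NormedAddCommGroup X] [NormedSpace ℝ X]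
    {I : Set ℝ} (hI : Convex ℝ I) {H : X → ℝ → ℝ}
    (hH : ContDiffOn ℝ 1 (fun p : X × ℝ => H p.1 p.2) (univ ×ˢ I)) {t : ℝ} (ht : t ∈ I)
    {S : Set X} (hS : IsCompact S) :
    ∃ K : ℝ, ∀ᶠ s in 𝓝[I] t, ∀ y ∈ S, |H y s - H y t| ≤ K * |s - t| := by
  refine hS.induction_on (p := fun S => ∃ K : ℝ, ∀ᶠ s in 𝓝[I] t, ∀ y ∈ S,
    |H y s - H y t| ≤ K * |s - t|) ⟨0, by simp⟩ ?_ ?_ ?_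
  · rintro A B hAB ⟨K, hK⟩
    exact ⟨K, hK.mono fun s hs y hy => hs y (hAB hy)⟩
  · rintro A B ⟨K, hK⟩ ⟨L, hL⟩
    refine ⟨max K L, ?_⟩
    filter_upwards [hK, hL] with s h1 h2 y hy
    rcases hy with hy | hy
    · exact (h1 y hy).trans (by gcongr; exact le_max_left _ _)
    · exact (h2 y hy).trans (by gcongr; exact le_max_right _ _)
  · intro y _
    obtain ⟨K, U, hU, hK⟩ := (hH (y, t) ⟨mem_univ _, ht⟩).exists_lipschitzOnWith
      (convex_univ.prod hI)
    rw [nhdsWithin_prod_eq, nhdsWithin_univ] at hU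
    obtain ⟨A, hA, B, hB, hAB⟩ := mem_prod_iff.1 hU
    refine ⟨A, mem_nhdsWithin_of_mem_nhds hA, K, ?_⟩
    filter_upwards [hB] with s hs z hz
    have := hK.dist_le_mul (z, s) (hAB ⟨hz, hs⟩) (z, t) (hAB ⟨hz, mem_of_mem_nhdsWithin ht hB⟩)
    simpa [Prod.dist_eq, Real.dist_eq] using this

theorem contDiff_slice {X F : Type*} [NormedAddCommGroup X] [NormedSpace ℝ X]
    [NormedAddCommGroup F] [NormedSpace ℝ F] {I : Set ℝ} {k : WithTop ℕ∞} {H : X → ℝ → F}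
    (hH : ContDiffOn ℝ k (fun p : X × ℝ => H p.1 p.2) (univ ×ˢ I)) {t : ℝ} (ht : t ∈ I) :
    ContDiff ℝ k fun x => H x t := by
  rw [← contDiffOn_univ]
  exact hH.comp (f := fun x : X => (x, t)) (by fun_prop) fun x _ => ⟨mem_univ _, ht⟩

/-- Differentiation under the integral sign over a compact set, within an interval. -/
theorem hasDerivWithinAt_setIntegral {X : Type*} [NormedAddCommGroup X] [NormedSpace ℝ X]
    [MeasurableSpace X] [BorelSpace X] {μ : Measure X} [IsFiniteMeasureOnCompacts μ]
    {I : Set ℝ} (hI : Convex ℝ I) {H : X → ℝ → ℝ}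
    (hH : ContDiffOn ℝ 1 (fun p : X × ℝ => H p.1 p.2) (univ ×ˢ I)) {t : ℝ} (ht : t ∈ I)
    {S : Set X} (hS : IsCompact S) {H' : X → ℝ}
    (hH' : ∀ y ∈ S, HasDerivWithinAt (H y) (H' y) I t) :
    HasDerivWithinAt (fun s => ∫ y in S, H y s ∂μ) (∫ y in S, H' y ∂μ) I t := by
  have hint : ∀ s ∈ I, IntegrableOn (fun y => H y s) S μ := fun s hs =>
    (contDiff_slice hH hs).continuous.continuousOn.integrableOn_compact hS
  obtain ⟨K, hK⟩ := exists_eventually_forall_abs_sub_le hI hH ht hS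
  have hle : 𝓝[I \ {t}] t ≤ 𝓝[I] t := nhdsWithin_mono _ sdiff_subset
  have hmem : ∀ᶠ s in 𝓝[I \ {t}] t, s ∈ I \ {t} := self_mem_nhdsWithin
  rw [hasDerivWithinAt_iff_tendsto_slope]
  have key : Tendsto (fun s => ∫ y in S, slope (H y) t s ∂μ) (𝓝[I \ {t}] t)
      (𝓝 (∫ y in S, H' y ∂μ)) := by
    -- The uniform Lipschitz constant in time dominates all difference quotients on `S`.
    refine tendsto_integral_filter_of_dominated_convergence (fun _ => K) ?_ ?_ ?_ ?_
    · filter_upwards [hmem] with s hs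
      simp only [slope_def_field]
      exact (((hint s hs.1).sub (hint t ht)).div_const _).aestronglyMeasurable
    · filter_upwards [hmem, hle hK] with s hs hs'
      filter_upwards [ae_restrict_mem hS.measurableSet] with y hy
      have h0 : 0 < |s - t| := abs_pos.2 (sub_ne_zero.2 hs.2)
      rw [slope_def_field, Real.norm_eq_abs, abs_div, div_le_iff₀ h0]
      exact hs' y hy
    · exact integrableOn_const hS.measure_lt_top.ne
    · filter_upwards [ae_restrict_mem hS.measurableSet] with y hy
      exact hasDerivWithinAt_iff_tendsto_slope.1 (hH' y hy)
  refine key.congr' ?_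
  filter_upwards [hmem] with s hs
  simp only [slope_def_field]
  rw [integral_div, integral_sub (hint s hs.1) (hint t ht)]

/-! ### Calculus of the divergence -/

theorem fderiv_apply_eq_sum {d : ℕ} {F : Type*} [NormedAddCommGroup F] [NormedSpace ℝ F]
    (L : E d →L[ℝ] F) (x : E d) : L x = ∑ i, x i • L (EuclideanSpace.single i 1) := by
  conv_lhs => rw [← (EuclideanSpace.basisFun (Fin d) ℝ).sum_repr x]
  simp [map_sum]

theorem divergence_smul {d : ℕ} {f : E d → ℝ} {w : E d → E d} {x : E d}
    (hf : DifferentiableAt ℝ f x) (hw : DifferentiableAt ℝ w x) :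
    divergence (fun y => f y • w y) x = fderiv ℝ f x (w x) + f x * divergence w x := by
  unfold divergence
  rw [fderiv_fun_smul hf hw, fderiv_apply_eq_sum (fderiv ℝ f x) (w x), Finset.mul_sum,
    ← Finset.sum_add_distrib]
  refine Finset.sum_congr rfl fun i _ => ?_
  simp
  ring

theorem divergence_sub {d : ℕ} {w u : E d → E d} {x : E d}
    (hw : DifferentiableAt ℝ w x) (hu : DifferentiableAt ℝ u x) :
    divergence (fun y => w y - u y) x = divergence w x - divergence u x := by
  simp [divergence, fderiv_fun_sub hw hu]

theorem divergence_add {d : ℕ} {w u : E d → E d} {x : E d}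
    (hw : DifferentiableAt ℝ w x) (hu : DifferentiableAt ℝ u x) :
    divergence (fun y => w y + u y) x = divergence w x + divergence u x := by
  simp [divergence, fderiv_fun_add hw hu, Finset.sum_add_distrib]

theorem divergence_const_smul_id {d : ℕ} (a : ℝ) (x : E d) :
    divergence (fun y => a • y) x = d * a := by
  have : fderiv ℝ (fun y : E d => a • y) x = a • ContinuousLinearMap.id ℝ (E d) := by
    simp [fderiv_fun_const_smul (differentiableAt_fun_id (x := x))]
  simp [divergence, this]

theorem continuous_divergence {d : ℕ} {w : E d → E d} (hw : ContDiff ℝ 1 w) :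
    Continuous (divergence w) := by
  have h := hw.continuous_fderiv one_ne_zero
  unfold divergence
  fun_prop

theorem divergence_congr {d : ℕ} {w u : E d → E d} {x : E d} (h : w =ᶠ[𝓝 x] u) :
    divergence w x = divergence u x := by
  simp [divergence, h.fderiv_eq]

/-! ### Reynolds' transport theorem for the ball -/

theorem setIntegral_closedBall_eq {d : ℕ} (f : E d → ℝ) {R : ℝ} (hR : 0 < R) :
    ∫ x in Metric.closedBall (0 : E d) R, f x =
      R ^ d * ∫ x in Metric.closedBall (0 : E d) 1, f (R • x) := by
  rw [Measure.setIntegral_comp_smul_of_pos volume f _ hR, _root_.smul_closedBall _ _ zero_le_one]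
  simp [abs_of_pos hR, hR.ne']

/-- Reynolds' transport theorem for the moving ball, in divergence form. -/
theorem hasDerivWithinAt_mass {d : ℕ} {I : Set ℝ} (hI : I.OrdConnected) (hI' : I.Nontrivial)
    {c ρmax : ℝ} {r : ℝ → ℝ} (hr : ContDiffOn ℝ 1 r I) (hrpos : ∀ t ∈ I, 0 < r t)
    {ρ : E d → ℝ → ℝ} {v : E d → ℝ → E d} (h : IsAdmissible 1 I c ρmax ρ v) {t : ℝ} (ht : t ∈ I) :
    HasDerivWithinAt (mass r ρ) (∫ x in Metric.closedBall (0 : E d) (r t),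
      divergence (fun y => ρ y t • ((derivWithin r I t / r t) • y - v y t)) x) I t := by
  have hu := uniqueDiffOn_of_ordConnected hI hI'
  have hrt := hrpos t ht
  set r' := derivWithin r I t with hr'
  have hdr : HasDerivWithinAt r r' I t := (hr.differentiableOn one_ne_zero t ht).hasDerivWithinAt
  have hρt : ContDiff ℝ 1 fun x => ρ x t := contDiff_slice h.contDiffOn_density ht
  have hvt : ContDiff ℝ 1 fun x => v x t := contDiff_slice h.contDiffOn_velocity ht
  -- the time derivative along the rescaled trajectories
  have hH : ContDiffOn ℝ 1 (fun p : E d × ℝ => ρ (r p.2 • p.1) p.2) (univ ×ˢ I) := by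
    have hr2 : ContDiffOn ℝ 1 (fun p : E d × ℝ => r p.2) (univ ×ˢ I) :=
      hr.comp contDiff_snd.contDiffOn fun p hp => hp.2
    exact h.contDiffOn_density.comp
      (f := fun p : E d × ℝ => (r p.2 • p.1, p.2))
      ((hr2.smul contDiff_fst.contDiffOn).prodMk contDiff_snd.contDiffOn)
      fun p hp => ⟨mem_univ _, hp.2⟩
  have hH' : ∀ y : E d, HasDerivWithinAt (fun s => ρ (r s • y) s)
      (fderiv ℝ (fun x => ρ x t) (r t • y) (r' • y) -
        divergence (fun x => ρ x t • v x t) (r t • y)) I t := by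
    intro y
    have hD := (h.contDiffOn_density.differentiableOn one_ne_zero (r t • y, t)
      ⟨mem_univ _, ht⟩).hasFDerivWithinAt
    set D := fderivWithin ℝ (fun p : E d × ℝ => ρ p.1 p.2) (univ ×ˢ I) (r t • y, t) with hDdef
    have h1 : HasDerivWithinAt (fun s => ρ (r s • y) s) (D (r' • y, 1)) I t :=
      hD.comp_hasDerivWithinAt (f := fun s => (r s • y, s)) t
        ((hdr.smul_const y).prodMk (hasDerivWithinAt_id t I)) fun s hs => ⟨mem_univ _, hs⟩
    have h2 : HasDerivWithinAt (fun s => ρ (r t • y) s) (D (0, 1)) I t :=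
      hD.comp_hasDerivWithinAt (f := fun s => (r t • y, s)) t
        ((hasDerivWithinAt_const t I _).prodMk (hasDerivWithinAt_id t I))
        fun s hs => ⟨mem_univ _, hs⟩
    have h3 : HasFDerivWithinAt (fun x => ρ x t)
        (D.comp (ContinuousLinearMap.inl ℝ (E d) ℝ)) univ (r t • y) :=
      hD.comp (f := fun x : E d => (x, t)) (r t • y)
        (hasFDerivAt_prodMk_left (r t • y) t).hasFDerivWithinAt fun x _ => ⟨mem_univ _, ht⟩
    have h4 := h.continuity_eq t ht (r t • y)
    rw [h2.derivWithin (hu t ht)] at h4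
    rw [hasFDerivWithinAt_univ] at h3
    rw [h3.fderiv]
    convert h1 using 1
    -- The trajectory derivative splits into a spatial part and a pure time part; the continuity
    -- equation evaluates the latter.
    have : ((r' • y, 1) : E d × ℝ) = (r' • y, 0) + (0, 1) := by simp
    rw [this, map_add]
    simp only [ContinuousLinearMap.comp_apply, ContinuousLinearMap.inl_apply]
    linarith
  have hB : IsCompact (Metric.closedBall (0 : E d) 1) := isCompact_closedBall 0 1
  have hJ := hasDerivWithinAt_setIntegral (μ := volume) hI.convex
    (H := fun y s => ρ (r s • y) s) hH ht hB fun y _ => hH' y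
  have hprod := (hdr.fun_pow d).mul hJ
  have hmass : ∀ s ∈ I, mass r ρ s =
      r s ^ d * ∫ y in Metric.closedBall (0 : E d) 1, ρ (r s • y) s := fun s hs =>
    setIntegral_closedBall_eq _ (hrpos s hs)
  refine (hprod.congr hmass (hmass t ht)).congr_deriv ?_
  rw [setIntegral_closedBall_eq _ hrt]
  have hdiv : ∀ y : E d, divergence (fun y => ρ y t • ((r' / r t) • y - v y t)) (r t • y) =
      (d * (r' / r t)) * ρ (r t • y) t + (fderiv ℝ (fun x => ρ x t) (r t • y) (r' • y) -
        divergence (fun x => ρ x t • v x t) (r t • y)) := by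
    intro y
    have e1 := hρt.differentiable one_ne_zero (r t • y)
    have e2 := hvt.differentiable one_ne_zero (r t • y)
    have e3 : DifferentiableAt ℝ (fun x : E d => (r' / r t) • x) (r t • y) := by fun_prop
    simp only [smul_sub]
    rw [divergence_sub (e1.fun_smul e3) (e1.fun_smul e2), divergence_smul e1 e3,
      divergence_const_smul_id, smul_smul, div_mul_cancel₀ _ hrt.ne']
    ring
  simp only [hdiv]
  have hc1 : Continuous fun y : E d => (d * (r' / r t)) * ρ (r t • y) t := by
    have := hρt.continuous
    fun_prop
  have hc2 : Continuous fun y : E d => fderiv ℝ (fun x => ρ x t) (r t • y) (r' • y) -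
      divergence (fun x => ρ x t • v x t) (r t • y) := by
    have i1 := hρt.continuous_fderiv one_ne_zero
    have i2 := continuous_divergence (hρt.smul hvt)
    exact ((i1.comp (continuous_const_smul _)).clm_apply (continuous_const_smul _)).sub
      (i2.comp (continuous_const_smul _))
  rw [integral_add (hc1.continuousOn.integrableOn_compact hB)
    (hc2.continuousOn.integrableOn_compact hB), integral_const_mul]
  -- The power rule produces the truncated exponent `d - 1`, so `d = 0` is separate.
  rcases Nat.eq_zero_or_pos d with rfl | hd
  · simp
  · obtain ⟨n, rfl⟩ := Nat.exists_eq_succ_of_ne_zero hd.ne'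
    simp only [Nat.succ_eq_add_one, Nat.add_sub_cancel]
    field_simp
    ring

/-! ### The flux estimate by radial cutoffs -/

theorem deriv_smoothTransition_nonneg (y : ℝ) : 0 ≤ deriv Real.smoothTransition y :=
  Real.smoothTransition.monotone.deriv_nonneg

/-- Every such point is a global minimum, which also covers the junction `y = 0`. -/
theorem deriv_smoothTransition_of_nonpos {y : ℝ} (hy : y ≤ 0) :
    deriv Real.smoothTransition y = 0 := by
  refine IsLocalMin.deriv_eq_zero (Eventually.of_forall fun z => ?_)
  rw [Real.smoothTransition.zero_of_nonpos hy]
  exact Real.smoothTransition.nonneg z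

/-- The integral of the gradient of a radial cutoff is at most the area of the sphere. -/
theorem integral_deriv_smoothTransition_le {d : ℕ} (hd : 0 < d) {R : ℝ} (hR : 0 < R) {n : ℝ}
    (hn : 0 ≤ n) :
    ∫ x : E d, 2 * n * ‖x‖ * deriv Real.smoothTransition (n * (R ^ 2 - ‖x‖ ^ 2)) ≤
      sphereArea d R := by
  have hSd : Differentiable ℝ Real.smoothTransition :=
    (Real.smoothTransition.contDiff (n := 1)).differentiable one_ne_zero
  have hSc : Continuous (deriv Real.smoothTransition) :=
    (Real.smoothTransition.contDiff (n := 1)).continuous_deriv le_rfl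
  have : Nontrivial (E d) := by
    have : Nonempty (Fin d) := ⟨⟨0, hd⟩⟩
    infer_instance
  set g : ℝ → ℝ := fun s => 2 * n * s * deriv Real.smoothTransition (n * (R ^ 2 - s ^ 2)) with hg
  have hgc : Continuous g := by fun_prop
  have hg0 : ∀ s, 0 ≤ s → 0 ≤ g s := fun s hs => by
    have := deriv_smoothTransition_nonneg (n * (R ^ 2 - s ^ 2))
    positivity
  have hgR : ∀ s, R ≤ s → g s = 0 := by
    intro s hs
    have : n * (R ^ 2 - s ^ 2) ≤ 0 := mul_nonpos_of_nonneg_of_nonpos hn (by nlinarith)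
    simp [hg, deriv_smoothTransition_of_nonpos this]
  -- `g` is minus the radial derivative of the cutoff, so its integral is the total drop, at most
  -- `1`. The weight `y ^ (d - 1)` is then bounded by its value at `R`.
  have hFTC : ∫ s in (0 : ℝ)..R, g s = Real.smoothTransition (n * R ^ 2) := by
    have := intervalIntegral.integral_eq_sub_of_hasDerivAt
      (f := fun s => - Real.smoothTransition (n * (R ^ 2 - s ^ 2))) (f' := g) (a := 0) (b := R)
      (fun s _ => by
        have h1 : HasDerivAt (fun s : ℝ => n * (R ^ 2 - s ^ 2)) (n * (-(2 * s))) s := by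
          simpa using (((hasDerivAt_id s).fun_pow 2).const_sub (R ^ 2)).const_mul n
        have := ((hSd _).hasDerivAt.comp s h1).fun_neg
        refine this.congr_deriv ?_
        simp only [hg]; ring) (hgc.intervalIntegrable _ _)
    rw [this]
    simp
  have hle : ∫ y in Ioi (0 : ℝ), y ^ (d - 1) • g y ≤ R ^ (d - 1) := by
    have h1 : ∫ y in Ioi (0 : ℝ), y ^ (d - 1) • g y = ∫ y in (0 : ℝ)..R, y ^ (d - 1) • g y := by
      rw [intervalIntegral.integral_of_le hR.le]
      refine setIntegral_eq_of_subset_of_forall_sdiff_eq_zero (s := Ioc 0 R) (t := Ioi 0)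
        measurableSet_Ioi
        (fun _ hx => hx.1) fun x hx => ?_
      rw [hgR x, smul_zero]
      by_contra hlt
      exact hx.2 ⟨hx.1, (not_le.1 hlt).le⟩
    rw [h1]
    calc ∫ y in (0 : ℝ)..R, y ^ (d - 1) • g y ≤ ∫ y in (0 : ℝ)..R, R ^ (d - 1) * g y := by
          refine intervalIntegral.integral_mono_on hR.le
            ((by fun_prop : Continuous fun y : ℝ => y ^ (d - 1) • g y).intervalIntegrable _ _)
            ((by fun_prop : Continuous fun y : ℝ => R ^ (d - 1) * g y).intervalIntegrable _ _) ?_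
          intro y hy
          exact mul_le_mul_of_nonneg_right (pow_le_pow_left₀ hy.1 hy.2 _) (hg0 y hy.1)
      _ = R ^ (d - 1) * Real.smoothTransition (n * R ^ 2) := by
          rw [intervalIntegral.integral_const_mul, hFTC]
      _ ≤ R ^ (d - 1) := mul_le_of_le_one_right (by positivity) (Real.smoothTransition.le_one _)
  have hmain := integral_fun_norm_addHaar (volume : Measure (E d)) g
  rw [finrank_euclideanSpace, Fintype.card_fin] at hmain
  change ∫ x : E d, g ‖x‖ ≤ _
  rw [hmain, sphereArea_eq d hR, nsmul_eq_mul, smul_eq_mul, ← mul_assoc]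
  exact mul_le_mul_of_nonneg_left hle (by positivity)

/-- The cutoffs `η n` increase to the indicator of the open ball. Integration by parts moves the
derivative onto `η n`, whose gradient has `L¹` norm at most the area for every `n`; no boundary
integral is needed. -/
theorem abs_setIntegral_divergence_le {d : ℕ} (hd : 0 < d) {w : E d → E d} (hw : ContDiff ℝ 1 w)
    {R K : ℝ} (hR : 0 < R) (hK : ∀ x ∈ Metric.closedBall (0 : E d) R, ‖w x‖ ≤ K) :
    |∫ x in Metric.closedBall (0 : E d) R, divergence w x| ≤ K * sphereArea d R := by
  have hK0 : 0 ≤ K := (norm_nonneg _).trans (hK 0 (by simp [hR.le]))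
  have hSC : ContDiff ℝ 1 Real.smoothTransition := Real.smoothTransition.contDiff (n := 1)
  have hSc : Continuous (deriv Real.smoothTransition) := hSC.continuous_deriv le_rfl
  set η : ℕ → E d → ℝ := fun n x => Real.smoothTransition (n * (R ^ 2 - ‖x‖ ^ 2)) with hη
  have hηC : ∀ n, ContDiff ℝ 1 (η n) := fun n => hSC.comp
    (contDiff_const.mul (contDiff_const.sub (contDiff_norm_sq ℝ)))
  have hη0 : ∀ n x, x ∉ Metric.closedBall (0 : E d) R → η n x = 0 := by
    intro n x hx
    have hx' : R < ‖x‖ := by simpa using hx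
    exact Real.smoothTransition.zero_of_nonpos
      (mul_nonpos_of_nonneg_of_nonpos (by positivity) (by nlinarith))
  have hηs : ∀ n, HasCompactSupport (η n) := fun n =>
    HasCompactSupport.intro (isCompact_closedBall 0 R) fun x hx => hη0 n x hx
  have hηd : ∀ n x y, fderiv ℝ (η n) x y =
      -(2 * n * inner ℝ x y * deriv Real.smoothTransition (n * (R ^ 2 - ‖x‖ ^ 2))) := by
    intro n x y
    have h1 : HasFDerivAt (fun x : E d => (n : ℝ) * (R ^ 2 - ‖x‖ ^ 2))
        ((n : ℝ) • -(2 • innerSL ℝ x : E d →L[ℝ] ℝ)) x :=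
      ((hasStrictFDerivAt_norm_sq x).hasFDerivAt.const_sub (R ^ 2)).const_mul (n : ℝ)
    have h2 := ((hSC.differentiable one_ne_zero _).hasDerivAt (x := (n : ℝ) * (R ^ 2 - ‖x‖ ^ 2))
      ).comp_hasFDerivAt x h1
    have : fderiv ℝ (η n) x = _ := h2.fderiv
    rw [this]
    simp
    ring
  have hparts : ∀ n, ∫ x, η n x * divergence w x = - ∫ x, fderiv ℝ (η n) x (w x) := by
    intro n
    have hwi : ∀ i, ContDiff ℝ 1 fun x => w x i := fun i => by fun_prop
    have hwd : ∀ i x, fderiv ℝ (fun x => w x i) x (EuclideanSpace.single i 1) =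
        (fderiv ℝ w x (EuclideanSpace.single i 1)) i := by
      intro i x
      have := ((EuclideanSpace.proj i : E d →L[ℝ] ℝ).hasFDerivAt.comp x
        (hw.differentiable one_ne_zero x).hasFDerivAt).fderiv
      exact congrArg (fun L => L (EuclideanSpace.single i 1)) this
    have c1 := fun i => (hwi i).continuous_fderiv one_ne_zero
    have c2 := (hηC n).continuous_fderiv one_ne_zero
    have c3 := fun i => (hwi i).continuous
    have c4 := (hηC n).continuous
    have hs' : ∀ i, HasCompactSupport fun x => fderiv ℝ (η n) x (EuclideanSpace.single i 1) :=
      fun i => (hηs n).fderiv_apply ℝ _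
    have i1 : ∀ i, Integrable fun x => fderiv ℝ (η n) x (EuclideanSpace.single i 1) * w x i :=
      fun i => Continuous.integrable_of_hasCompactSupport
        ((c2.clm_apply continuous_const).mul (c3 i)) (hs' i).mul_right
    have i2 : ∀ i, Integrable fun x =>
        η n x * fderiv ℝ (fun x => w x i) x (EuclideanSpace.single i 1) :=
      fun i => Continuous.integrable_of_hasCompactSupport
        (c4.mul ((c1 i).clm_apply continuous_const)) (hηs n).mul_right
    have i3 : ∀ i, Integrable fun x => η n x * w x i :=
      fun i => Continuous.integrable_of_hasCompactSupport (c4.mul (c3 i)) (hηs n).mul_right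
    have e1 : ∀ x, η n x * divergence w x =
        ∑ i, η n x * fderiv ℝ (fun x => w x i) x (EuclideanSpace.single i 1) := by
      intro x
      simp only [divergence, hwd, Finset.mul_sum]
    have e2 : ∀ x, fderiv ℝ (η n) x (w x) =
        ∑ i, fderiv ℝ (η n) x (EuclideanSpace.single i 1) * w x i := by
      intro x
      rw [fderiv_apply_eq_sum]
      simp [mul_comm]
    simp only [e1, e2]
    rw [integral_finsetSum _ fun i _ => i2 i, integral_finsetSum _ fun i _ => i1 i,
      ← Finset.sum_neg_distrib]
    refine Finset.sum_congr rfl fun i _ => ?_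
    exact integral_mul_fderiv_eq_neg_fderiv_mul_of_integrable (i1 i) (i2 i) (i3 i)
      (fun x _ => (hηC n).differentiable one_ne_zero x)
      (fun x _ => (hwi i).differentiable one_ne_zero x)
  have hbound : ∀ n : ℕ, |∫ x, η n x * divergence w x| ≤ K * sphereArea d R := by
    intro n
    rw [hparts, abs_neg]
    set g : E d → ℝ := fun x =>
      2 * n * ‖x‖ * deriv Real.smoothTransition (n * (R ^ 2 - ‖x‖ ^ 2)) with hg
    have hgc : Continuous g := by fun_prop
    have hgs : ∀ x, x ∉ Metric.closedBall (0 : E d) R → g x = 0 := by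
      intro x hx
      have hx' : R < ‖x‖ := by simpa using hx
      have : (n : ℝ) * (R ^ 2 - ‖x‖ ^ 2) ≤ 0 :=
        mul_nonpos_of_nonneg_of_nonpos (by positivity) (by nlinarith)
      simp [hg, deriv_smoothTransition_of_nonpos this]
    have hgi : Integrable g := hgc.integrable_of_hasCompactSupport
      (HasCompactSupport.intro (isCompact_closedBall 0 R) fun x hx => hgs x hx)
    calc |∫ x, fderiv ℝ (η n) x (w x)| ≤ ∫ x, K * g x := by
          rw [← Real.norm_eq_abs]
          refine norm_integral_le_of_norm_le (hgi.const_mul K) (Eventually.of_forall fun x => ?_)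
          have h0 := deriv_smoothTransition_nonneg (n * (R ^ 2 - ‖x‖ ^ 2))
          rw [hηd, Real.norm_eq_abs, abs_neg, abs_mul, abs_mul, abs_of_nonneg h0,
            abs_of_nonneg (by positivity : (0 : ℝ) ≤ 2 * n)]
          by_cases hx : x ∈ Metric.closedBall (0 : E d) R
          · have h1 : |inner ℝ x (w x)| ≤ ‖x‖ * K :=
              (abs_real_inner_le_norm _ _).trans (by gcongr; exact hK x hx)
            calc _ ≤ 2 * n * (‖x‖ * K) *
                  deriv Real.smoothTransition (n * (R ^ 2 - ‖x‖ ^ 2)) := by gcongr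
              _ = K * g x := by simp only [hg]; ring
          · have hx' : R < ‖x‖ := by simpa using hx
            rw [hgs x hx, deriv_smoothTransition_of_nonpos
              (mul_nonpos_of_nonneg_of_nonpos (by positivity) (by nlinarith))]
            simp
      _ ≤ K * sphereArea d R := by
          rw [integral_const_mul]
          exact mul_le_mul_of_nonneg_left
            (integral_deriv_smoothTransition_le hd hR (by positivity)) hK0
  have hcd := continuous_divergence hw
  have hlim : Tendsto (fun n => ∫ x, η n x * divergence w x) atTop
      (𝓝 (∫ x in Metric.closedBall (0 : E d) R, divergence w x)) := by
    rw [← integral_indicator Metric.isClosed_closedBall.measurableSet]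
    have hball : IsCompact (Metric.closedBall (0 : E d) R) := isCompact_closedBall 0 R
    refine tendsto_integral_filter_of_dominated_convergence
      ((Metric.closedBall (0 : E d) R).indicator fun x => |divergence w x|) ?_ ?_ ?_ ?_
    · exact Eventually.of_forall fun n =>
        ((hηC n).continuous.mul hcd).aestronglyMeasurable
    · refine Eventually.of_forall fun n => Eventually.of_forall fun x => ?_
      by_cases hx : x ∈ Metric.closedBall (0 : E d) R
      · rw [indicator_of_mem hx, norm_mul, Real.norm_eq_abs, Real.norm_eq_abs,
          abs_of_nonneg (Real.smoothTransition.nonneg _)]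
        exact mul_le_of_le_one_left (abs_nonneg _) (Real.smoothTransition.le_one _)
      · simp [indicator_of_notMem hx, hη0 n x hx]
    · exact (integrable_indicator_iff hball.measurableSet).2
        (hcd.abs.continuousOn.integrableOn_compact hball)
    -- On the sphere itself `η n` vanishes while the indicator is `1`, but the sphere is null.
    · have hsph : ∀ᵐ x : E d, x ∉ Metric.sphere (0 : E d) R :=
        measure_eq_zero_iff_ae_notMem.1 (Measure.addHaar_sphere_of_ne_zero _ _ hR.ne')
      filter_upwards [hsph] with x hx
      have hne : ‖x‖ ≠ R := by simpa using hx
      rcases hne.lt_or_gt with hlt | hgt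
      · have hpos : 0 < R ^ 2 - ‖x‖ ^ 2 := by nlinarith [norm_nonneg x]
        rw [indicator_of_mem (by simpa using hlt.le)]
        refine tendsto_const_nhds.congr' ?_
        filter_upwards [(tendsto_natCast_atTop_atTop.atTop_mul_const hpos).eventually_ge_atTop 1]
          with n hn
        simp only [hη]
        rw [Real.smoothTransition.one_of_one_le hn, one_mul]
      · have hx' : x ∉ Metric.closedBall (0 : E d) R := by simpa using hgt
        rw [indicator_of_notMem hx']
        simp [hη0 _ x hx']
  exact le_of_tendsto (continuous_abs.tendsto _ |>.comp hlim) (Eventually.of_forall hbound)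

/-! ### Pointwise form of the sup norms and the growth bound -/

/-- By continuity the set where the bound fails is open, and an open null set is empty. -/
theorem eLpNorm_top_le_iff {d : ℕ} {F : Type*} [NormedAddCommGroup F] {f : E d → F}
    (hf : Continuous f) {K : ℝ} (hK : 0 ≤ K) :
    eLpNorm f ⊤ volume ≤ ENNReal.ofReal K ↔ ∀ x, ‖f x‖ ≤ K := by
  constructor
  · intro h
    have hae : ∀ᵐ x, ‖f x‖ ≤ K := by
      filter_upwards [enorm_ae_le_eLpNormEssSup f volume] with x hx
      rw [eLpNorm_exponent_top] at h
      have := hx.trans h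
      rw [← ofReal_norm] at this
      exact (ENNReal.ofReal_le_ofReal_iff hK).1 this
    have hopen : IsOpen {x | K < ‖f x‖} := isOpen_lt continuous_const hf.norm
    have h0 : volume {x | K < ‖f x‖} = 0 := by
      simpa [ae_iff, not_le] using hae
    have := (hopen.measure_eq_zero_iff volume).1 h0
    intro x
    by_contra hx
    exact (this ▸ (not_le.1 hx : x ∈ {x | K < ‖f x‖}) : x ∈ (∅ : Set (E d)))
  · intro h
    rw [eLpNorm_exponent_top]
    exact eLpNormEssSup_le_of_ae_bound (Eventually.of_forall h)

theorem eLpNorm_top_eq {d : ℕ} {F : Type*} [NormedAddCommGroup F] {f : E d → F}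
    (hf : Continuous f) {K : ℝ} (hle : ∀ x, ‖f x‖ ≤ K) {x₀ : E d} (hx₀ : ‖f x₀‖ = K) :
    eLpNorm f ⊤ volume = ENNReal.ofReal K := by
  have hK : 0 ≤ K := hx₀ ▸ norm_nonneg _
  refine le_antisymm ((eLpNorm_top_le_iff hf hK).2 hle) ?_
  have htop : eLpNorm f ⊤ volume ≠ ⊤ :=
    (((eLpNorm_top_le_iff hf hK).2 hle).trans_lt ENNReal.ofReal_lt_top).ne
  have := (eLpNorm_top_le_iff hf ENNReal.toReal_nonneg).1 (ENNReal.ofReal_toReal htop).ge x₀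
  rw [hx₀] at this
  exact (ENNReal.ofReal_le_iff_le_toReal htop).2 this

theorem abs_derivWithin_mass_le {d : ℕ} (hd : 0 < d) {I : Set ℝ} (hI : I.OrdConnected)
    (hI' : I.Nontrivial) {c ρmax : ℝ} (hc : 0 ≤ c) (hρmax : 0 ≤ ρmax)
    {r : ℝ → ℝ} (hr : ContDiffOn ℝ 1 r I) (hrpos : ∀ t ∈ I, 0 < r t)
    {ρ : E d → ℝ → ℝ} {v : E d → ℝ → E d} (h : IsAdmissible 1 I c ρmax ρ v) {t : ℝ} (ht : t ∈ I) :
    |derivWithin (mass r ρ) I t| ≤ ρmax * (c + |derivWithin r I t|) * sphereArea d (r t) := by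
  rw [(hasDerivWithinAt_mass hI hI' hr hrpos h ht).derivWithin
    (uniqueDiffOn_of_ordConnected hI hI' t ht)]
  have hρt : ContDiff ℝ 1 fun x => ρ x t := contDiff_slice h.contDiffOn_density ht
  have hvt : ContDiff ℝ 1 fun x => v x t := contDiff_slice h.contDiffOn_velocity ht
  have hrt := hrpos t ht
  have hw : ContDiff ℝ 1 fun y => ρ y t • ((derivWithin r I t / r t) • y - v y t) :=
    hρt.smul (ContDiff.sub (by fun_prop) hvt)
  refine abs_setIntegral_divergence_le hd hw hrt fun x hx => ?_
  have h1 := (eLpNorm_top_le_iff hρt.continuous hρmax).1 (h.density_le t ht) x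
  have h2 := (eLpNorm_top_le_iff hvt.continuous hc).1 (h.velocity_le t ht) x
  have hx' : ‖x‖ ≤ r t := by simpa using hx
  rw [norm_smul]
  refine mul_le_mul h1 ?_ (norm_nonneg _) hρmax
  refine (norm_sub_le _ _).trans ?_
  rw [add_comm, norm_smul, Real.norm_eq_abs, abs_div, abs_of_pos hrt]
  refine add_le_add h2 ?_
  rw [div_mul_eq_mul_div, div_le_iff₀ hrt]
  gcongr

theorem exists_Ici_subset_of_not_bddAbove {I : Set ℝ} (hI : I.OrdConnected) (hub : ¬ BddAbove I) :
    ∃ a, Ici a ⊆ I := by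
  obtain ⟨a, ha, -⟩ := not_bddAbove_iff.1 hub 0
  refine ⟨a, fun x hx => ?_⟩
  obtain ⟨b, hb, hxb⟩ := not_bddAbove_iff.1 hub x
  exact hI.out ha hb ⟨hx, hxb.le⟩

theorem derivWithin_mass_isBigO {d : ℕ} (hd : 0 < d) {I : Set ℝ} (hI : I.OrdConnected)
    (hI' : I.Nontrivial) {c ρmax : ℝ} (hc : 0 ≤ c) (hρmax : 0 ≤ ρmax)
    {r : ℝ → ℝ} (hr : ContDiffOn ℝ 1 r I) (hrpos : ∀ t ∈ I, 0 < r t)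
    (hr' : ∀ t ∈ I, |derivWithin r I t| ≤ c)
    {ρ : E d → ℝ → ℝ} {v : E d → ℝ → E d} (h : IsAdmissible 1 I c ρmax ρ v)
    (hub : ¬ BddAbove I) (hrO : r =O[atTop] (fun t : ℝ => t)) :
    derivWithin (mass r ρ) I =O[atTop] (fun t : ℝ => t ^ (d - 1)) := by
  obtain ⟨a, haI⟩ := exists_Ici_subset_of_not_bddAbove hI hub
  refine IsBigO.trans (g := fun t => r t ^ (d - 1)) ?_ (hrO.pow _)
  refine IsBigO.of_bound (ρmax * (c + c) * (d * (volume (Metric.ball (0 : E d) 1)).toReal)) ?_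
  filter_upwards [eventually_ge_atTop a] with t hta
  have ht : t ∈ I := haI hta
  have h1 := abs_derivWithin_mass_le hd hI hI' hc hρmax hr hrpos h ht
  have hrt := hrpos t ht
  rw [sphereArea_eq d hrt] at h1
  rw [Real.norm_eq_abs, Real.norm_eq_abs, abs_of_nonneg (pow_nonneg hrt.le _)]
  refine h1.trans ?_
  have h2 := hr' t ht
  have h3 := pow_nonneg hrt.le (d - 1)
  calc _ ≤ ρmax * (c + c) * (d * (volume (Metric.ball (0 : E d) 1)).toReal * r t ^ (d - 1)) := by
        gcongr
    _ = _ := by ring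

/-! ### Achievability of the constant -/

theorem divergence_smul_single_eq_zero {d : ℕ} {i j : Fin d} (hij : i ≠ j) {k : ℝ → ℝ}
    (hk : Differentiable ℝ k) (x : E d) :
    divergence (fun y : E d => k (y j) • EuclideanSpace.single i (1 : ℝ)) x = 0 := by
  have hp : HasFDerivAt (fun y : E d => y j) (EuclideanSpace.proj j : E d →L[ℝ] ℝ) x :=
    (EuclideanSpace.proj j : E d →L[ℝ] ℝ).hasFDerivAt
  have hf := (hk (x j)).hasDerivAt.comp_hasFDerivAt x hp
  rw [divergence_smul (f := fun y : E d => k (y j)) hf.differentiableAt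
    (differentiableAt_const _)]
  have h0 : fderiv ℝ (fun y : E d => k (y j)) x = _ := hf.fderiv
  rw [h0]
  simp [divergence, hij.symm]

theorem contDiff_divergence {d : ℕ} {w : E d → E d} (hw : ContDiff ℝ ∞ w) :
    ContDiff ℝ ∞ (divergence w) := by
  have h : ContDiff ℝ ∞ (fderiv ℝ w) := hw.fderiv_right (m := ∞) (by simp)
  unfold divergence
  fun_prop

/-- A smooth admissible pair attaining both sup norms at all times, which at the time `t₀` has
constant density and linear velocity field in a neighbourhood of the ball of radius `R`. -/
theorem exists_isAdmissible_linear {d : ℕ} (hd : 2 ≤ d) {I : Set ℝ} (hI : I.OrdConnected)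
    (hI' : I.Nontrivial) {c ρmax : ℝ} (hc : 0 < c) (hρmax : 0 < ρmax) {R : ℝ} (hR : 0 < R)
    {ε : ℝ} (hε : 0 < ε) (hε1 : ε < 1) {e : ℝ} (he : |e| = 1) (t₀ : ℝ) :
    ∃ (ρ : E d → ℝ → ℝ) (v : E d → ℝ → E d), IsAdmissible ∞ I c ρmax ρ v ∧
      (∀ s ∈ I, eLpNorm (fun x => ρ x s) ⊤ volume = ENNReal.ofReal ρmax) ∧
      (∀ s ∈ I, eLpNorm (fun x => v x s) ⊤ volume = ENNReal.ofReal c) ∧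
      ∃ R', R < R' ∧ ∀ x ∈ Metric.ball (0 : E d) R', ρ x t₀ = (1 - ε) * ρmax ∧
        v x t₀ = (-(e * (c * (1 - ε) / (1 + ε)) / R)) • x := by
  have hu := uniqueDiffOn_of_ordConnected hI hI'
  set i₀ : Fin d := ⟨0, by omega⟩ with hi₀
  set i₁ : Fin d := ⟨1, by omega⟩ with hi₁
  have hij : i₀ ≠ i₁ := by simp [hi₀, hi₁]
  set σ : ℝ := (1 - ε) * ρmax with hσ
  have h1ε : 0 < 1 - ε := by linarith
  have hσ0 : 0 < σ := by positivity
  have hσle : σ ≤ ρmax := by nlinarith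
  set b : ℝ := (1 + ε) * R with hb
  have hb0 : 0 < b := by positivity
  -- The inner radius exceeds `R`, so the field is linear on a neighbourhood of the closed ball.
  let χ : ContDiffBump (0 : E d) :=
    ⟨(1 + ε / 2) * R, b, by positivity, by rw [hb]; gcongr; linarith⟩
  have hχC : ContDiff ℝ ∞ χ := χ.contDiff
  set q : ℝ := e * (c * (1 - ε) / (1 + ε)) / R with hq
  have hqabs : |q| * b = c * (1 - ε) := by
    rw [hq, abs_div, abs_mul, he, abs_of_pos hR, abs_of_pos (by positivity), hb]
    field_simp
  set F : E d → E d := fun x => (-(σ * q) * χ x) • x with hF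
  have hFC : ContDiff ℝ ∞ F := ContDiff.smul (contDiff_const.mul hχC) contDiff_fun_id
  have hFout : ∀ x, b ≤ ‖x‖ → F x = 0 := by
    intro x hx
    simp [hF, χ.zero_of_le_dist (x := x) (by simpa [χ] using hx)]
  have hFle : ∀ x, ‖F x‖ ≤ σ * (c * (1 - ε)) := by
    intro x
    rcases le_total b ‖x‖ with hx | hx
    · rw [hFout x hx, norm_zero]; positivity
    · rw [hF, norm_smul, Real.norm_eq_abs, abs_mul, abs_neg, abs_mul, abs_of_pos hσ0,
        abs_of_nonneg χ.nonneg, ← hqabs]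
      calc σ * |q| * χ x * ‖x‖ ≤ σ * |q| * 1 * b := by gcongr; exact χ.le_one
        _ = σ * (|q| * b) := by ring
  set D : E d → ℝ := divergence F with hD
  have hDC : ContDiff ℝ ∞ D := contDiff_divergence hFC
  have hDout : ∀ x, b < ‖x‖ → D x = 0 := by
    intro x hx
    have : F =ᶠ[𝓝 x] fun _ => 0 := by
      filter_upwards [(isOpen_lt continuous_const continuous_norm).mem_nhds hx] with y hy
      exact hFout y (le_of_lt hy)
    rw [hD, divergence_congr this]
    simp [divergence]
  have hDs : HasCompactSupport D := HasCompactSupport.intro (isCompact_closedBall (0 : E d) b)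
    fun x hx => hDout x (by simpa using hx)
  obtain ⟨K₀, hK₀⟩ := hDs.exists_bound_of_continuous hDC.continuous
  set K : ℝ := max K₀ 1
  have hKpos : 0 < K := lt_of_lt_of_le one_pos (le_max_right _ _)
  have hDK : ∀ x, |D x| ≤ K := fun x => (hK₀ x).trans (le_max_left _ _)
  -- The time scale is chosen so that the density oscillates by at most `δ K = ε σ`.
  set δ : ℝ := ε * σ / K with hδ
  have hδ0 : 0 < δ := by positivity
  have hδK : δ * K = ε * σ := by rw [hδ]; field_simp
  set S : ℝ → ℝ := fun z => Real.smoothTransition (z - b) with hS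
  have hSC : ContDiff ℝ ∞ S := Real.smoothTransition.contDiff.comp (by fun_prop)
  have hSout : ∀ x : E d, S (x i₁) ≠ 0 → b < ‖x‖ := by
    intro x hx
    have h1 : b < x i₁ := by
      by_contra hle
      exact hx (Real.smoothTransition.zero_of_nonpos (by linarith [not_lt.1 hle]))
    exact h1.trans_le ((le_abs_self _).trans (PiLp.norm_apply_le x i₁))
  have hS0 : ∀ z, 0 ≤ S z := fun z => Real.smoothTransition.nonneg _
  have hS1 : ∀ z, S z ≤ 1 := fun z => Real.smoothTransition.le_one _
  -- The flux `ρ v` is `cos · F` plus a shear, and `∂ₜρ = -cos · div F`. The term with `S` raises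
  -- the density to `ρmax` only where `x i₁ > b`, outside the support of `F`.
  set ρ : E d → ℝ → ℝ := fun x s =>
    σ + (ρmax - σ) * S (x i₁) - δ * Real.sin ((s - t₀) / δ) * D x with hρ
  set v : E d → ℝ → E d := fun x s =>
    (Real.cos ((s - t₀) / δ) / ρ x s) • F x + (c * S (x i₁)) • EuclideanSpace.single i₀ (1 : ℝ)
    with hv
  have hρeq : ∀ x s, S (x i₁) ≠ 0 → ρ x s = σ + (ρmax - σ) * S (x i₁) := by
    intro x s hx
    simp [hρ, hDout x (hSout x hx)]
  have hosc : ∀ x s, |δ * Real.sin ((s - t₀) / δ) * D x| ≤ ε * σ := by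
    intro x s
    rw [abs_mul, abs_mul, abs_of_pos hδ0, ← hδK]
    calc δ * |Real.sin ((s - t₀) / δ)| * |D x| ≤ δ * 1 * K := by
          gcongr
          · exact Real.abs_sin_le_one _
          · exact hDK x
      _ = δ * K := by ring
  have hρlow : ∀ x s, (1 - ε) * σ ≤ ρ x s := by
    intro x s
    have h1 := (abs_le.1 (hosc x s)).2
    have h2 : 0 ≤ (ρmax - σ) * S (x i₁) := mul_nonneg (by linarith) (hS0 _)
    simp only [hρ]
    linarith
  have hρpos : ∀ x s, 0 < ρ x s := fun x s => (by positivity : 0 < (1 - ε) * σ).trans_le (hρlow x s)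
  have hρle : ∀ x s, ρ x s ≤ ρmax := by
    intro x s
    by_cases hx : S (x i₁) = 0
    · have h1 := (abs_le.1 (hosc x s)).1
      simp only [hρ, hx]
      have : σ + ε * σ ≤ ρmax := by rw [hσ]; nlinarith
      linarith
    · rw [hρeq x s hx]
      nlinarith [hS1 (x i₁)]
  -- The factor `1 - ε` in `‖F‖ ≤ σ c (1 - ε)` pays for the lower bound `(1 - ε) σ` of the density.
  have hvle : ∀ x s, ‖v x s‖ ≤ c := by
    intro x s
    by_cases hx : S (x i₁) = 0
    · simp only [hv, hx, mul_zero, zero_smul, add_zero]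
      rw [norm_smul, Real.norm_eq_abs, abs_div, abs_of_pos (hρpos x s), div_mul_eq_mul_div,
        div_le_iff₀ (hρpos x s)]
      calc |Real.cos ((s - t₀) / δ)| * ‖F x‖ ≤ 1 * (σ * (c * (1 - ε))) := by
            gcongr
            · exact Real.abs_cos_le_one _
            · exact hFle x
        _ = c * ((1 - ε) * σ) := by ring
        _ ≤ c * ρ x s := by gcongr; exact hρlow x s
    · simp only [hv, hFout x (hSout x hx).le, smul_zero, zero_add]
      rw [norm_smul, Real.norm_eq_abs, abs_of_nonneg (mul_nonneg hc.le (hS0 _))]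
      simpa using mul_le_of_le_one_right hc.le (hS1 (x i₁))
  have hρC : ContDiff ℝ ∞ fun p : E d × ℝ => ρ p.1 p.2 := by
    have h1 : ContDiff ℝ ∞ fun p : E d × ℝ => S (p.1 i₁) := hSC.comp (by fun_prop)
    have h2 : ContDiff ℝ ∞ fun p : E d × ℝ => D p.1 := hDC.comp contDiff_fst
    have h3 : ContDiff ℝ ∞ fun p : E d × ℝ => Real.sin ((p.2 - t₀) / δ) :=
      Real.contDiff_sin.comp (by fun_prop)
    exact (contDiff_const.add (contDiff_const.mul h1)).sub ((contDiff_const.mul h3).mul h2)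
  have hvC : ContDiff ℝ ∞ fun p : E d × ℝ => v p.1 p.2 := by
    have h1 : ContDiff ℝ ∞ fun p : E d × ℝ => S (p.1 i₁) := hSC.comp (by fun_prop)
    have h2 : ContDiff ℝ ∞ fun p : E d × ℝ => F p.1 := hFC.comp contDiff_fst
    have h3 : ContDiff ℝ ∞ fun p : E d × ℝ => Real.cos ((p.2 - t₀) / δ) :=
      Real.contDiff_cos.comp (by fun_prop)
    exact ((h3.div hρC fun p => (hρpos _ _).ne').smul h2).add
      ((contDiff_const.mul h1).smul contDiff_const)
  have hρs : ∀ s, Continuous fun x => ρ x s := fun s =>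
    (contDiff_slice (I := univ) (hρC.contDiffOn) (mem_univ s)).continuous
  have hvs : ∀ s, Continuous fun x => v x s := fun s =>
    (contDiff_slice (I := univ) (hvC.contDiffOn) (mem_univ s)).continuous
  set x₁ : E d := (b + 1) • EuclideanSpace.single i₁ (1 : ℝ) with hx₁
  have hSx₁ : S (x₁ i₁) = 1 := by
    simp only [hS, hx₁]
    exact Real.smoothTransition.one_of_one_le (by simp)
  have hρnorm : ∀ s, eLpNorm (fun x => ρ x s) ⊤ volume = ENNReal.ofReal ρmax := by
    intro s
    refine eLpNorm_top_eq (hρs s) (x₀ := x₁) (fun x => ?_) ?_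
    · rw [Real.norm_eq_abs, abs_of_pos (hρpos x s)]
      exact hρle x s
    · rw [Real.norm_eq_abs, abs_of_pos (hρpos x₁ s), hρeq _ _ (by simp [hSx₁]), hSx₁]
      ring
  have hvnorm : ∀ s, eLpNorm (fun x => v x s) ⊤ volume = ENNReal.ofReal c := by
    intro s
    refine eLpNorm_top_eq (hvs s) (x₀ := x₁) (fun x => hvle x s) ?_
    simp only [hv, hFout x₁ (hSout x₁ (by simp [hSx₁])).le, hSx₁]
    rw [smul_zero, zero_add, norm_smul, Real.norm_eq_abs, mul_one, abs_of_pos hc]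
    simp
  refine ⟨ρ, v, ⟨hρC.contDiffOn, hvC.contDiffOn, fun s _ x => (hρpos x s).le, ?_,
    fun s _ => (hρnorm s).le, fun s _ => (hvnorm s).le⟩, fun s _ => hρnorm s, fun s _ => hvnorm s,
    (1 + ε / 2) * R, by nlinarith, ?_⟩
  · intro s hs x
    have hdt : HasDerivAt (fun s => ρ x s) (-(Real.cos ((s - t₀) / δ) * D x)) s := by
      have h1 : HasDerivAt (fun s : ℝ => (s - t₀) / δ) (1 / δ) s :=
        ((hasDerivAt_id s).sub_const t₀).div_const δ
      have h2 := ((h1.sin.const_mul δ).mul_const (D x)).const_sub (σ + (ρmax - σ) * S (x i₁))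
      refine h2.congr_deriv ?_
      field_simp
    have hflux : (fun y => ρ y s • v y s) = fun y => Real.cos ((s - t₀) / δ) • F y +
        (c * (σ + (ρmax - σ) * S (y i₁)) * S (y i₁)) • EuclideanSpace.single i₀ (1 : ℝ) := by
      funext y
      simp only [hv, smul_add, smul_smul]
      congr 2
      · rw [mul_div_cancel₀ _ (hρpos y s).ne']
      · by_cases hy : S (y i₁) = 0
        · simp [hy]
        · rw [hρeq y s hy]; ring
    have hk : Differentiable ℝ fun z => c * (σ + (ρmax - σ) * S z) * S z := by
      have := hSC.differentiable (by simp)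
      fun_prop
    have hFd := hFC.differentiable (by simp) x
    have hk' : Differentiable ℝ fun y : E d => c * (σ + (ρmax - σ) * S (y i₁)) * S (y i₁) :=
      hk.comp (by fun_prop : Differentiable ℝ fun y : E d => y i₁)
    have hk'' : DifferentiableAt ℝ (fun y : E d => (c * (σ + (ρmax - σ) * S (y i₁)) * S (y i₁)) •
        (EuclideanSpace.single i₀ (1 : ℝ) : E d)) x := (hk' x).smul_const _
    rw [hdt.hasDerivWithinAt.derivWithin (hu s hs), hflux, divergence_add
      (hFd.fun_const_smul _) hk'', divergence_smul_single_eq_zero hij hk,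
      divergence_smul (differentiableAt_const _) hFd, fderiv_fun_const]
    simp [D]
  · intro x hx
    have hxb : ‖x‖ < (1 + ε / 2) * R := by simpa using hx
    have hxS : S (x i₁) = 0 := by
      by_contra hne
      have := hSout x hne
      rw [hb] at this
      nlinarith
    have hρx : ρ x t₀ = σ := by simp [hρ, hxS]
    refine ⟨hρx, ?_⟩
    have hχ1 : χ x = 1 := χ.one_of_mem_closedBall (by simpa [χ] using hxb.le)
    have hvx : v x t₀ = (1 / σ) • ((-(σ * q) * 1) • x) := by
      simp only [hv, hxS, hρx, sub_self, zero_div, Real.cos_zero, mul_zero, zero_smul, add_zero]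
      rw [← hχ1]
    rw [hvx, smul_smul]
    congr 1
    field_simp

/-- With `e` the sign of `r'`, the radial flow opposes the boundary motion, so the two speeds add.
The Reynolds integrand is constant on the ball, and the loss is controlled by `(1 - 3ε)(1 + ε) ≤ (1
- ε)²`. -/
theorem exists_isAdmissible_rate_ge {d : ℕ} (hd : 2 ≤ d) {I : Set ℝ} (hI : I.OrdConnected)
    (hI' : I.Nontrivial) {c ρmax : ℝ} (hc : 0 < c) (hρmax : 0 < ρmax)
    {r : ℝ → ℝ} (hr : ContDiffOn ℝ 1 r I) (hrpos : ∀ t ∈ I, 0 < r t)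
    {ε : ℝ} (hε : 0 < ε) (hε1 : ε < 1) {t : ℝ} (ht : t ∈ I) :
    ∃ (ρ : E d → ℝ → ℝ) (v : E d → ℝ → E d), IsAdmissible ∞ I c ρmax ρ v ∧
      (∀ s ∈ I, eLpNorm (fun x => ρ x s) ⊤ volume = ENNReal.ofReal ρmax) ∧
      (∀ s ∈ I, eLpNorm (fun x => v x s) ⊤ volume = ENNReal.ofReal c) ∧
      (1 - 3 * ε) * (ρmax * (c + |derivWithin r I t|) * sphereArea d (r t))
        ≤ |derivWithin (mass r ρ) I t| := by
  have hrt := hrpos t ht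
  set r' := derivWithin r I t with hr'
  obtain ⟨e, he, her⟩ : ∃ e : ℝ, |e| = 1 ∧ r' = e * |r'| := by
    rcases le_total 0 r' with h | h
    · exact ⟨1, by simp, by rw [abs_of_nonneg h, one_mul]⟩
    · exact ⟨-1, by simp, by rw [abs_of_nonpos h]; ring⟩
  obtain ⟨ρ, v, hadm, hρn, hvn, R', hR', hloc⟩ :=
    exists_isAdmissible_linear hd hI hI' hc hρmax hrt hε hε1 he t
  refine ⟨ρ, v, hadm, hρn, hvn, ?_⟩
  have hadm1 : IsAdmissible 1 I c ρmax ρ v :=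
    ⟨hadm.contDiffOn_density.of_le (by simp), hadm.contDiffOn_velocity.of_le (by simp),
      hadm.nonneg, hadm.continuity_eq, hadm.density_le, hadm.velocity_le⟩
  set q : ℝ := c * (1 - ε) / (1 + ε) with hq
  have hdiv : ∀ x ∈ Metric.closedBall (0 : E d) (r t),
      divergence (fun y => ρ y t • ((r' / r t) • y - v y t)) x =
        d * ((1 - ε) * ρmax * (e * (|r'| + q)) / r t) := by
    intro x hx
    have hx' : x ∈ Metric.ball (0 : E d) R' := Metric.closedBall_subset_ball hR' hx
    rw [← divergence_const_smul_id _ x]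
    refine divergence_congr ?_
    filter_upwards [Metric.isOpen_ball.mem_nhds hx'] with y hy
    obtain ⟨h1, h2⟩ := hloc y hy
    rw [h1, h2, ← sub_smul, smul_smul]
    congr 1
    conv_lhs => rw [her]
    ring
  rw [(hasDerivWithinAt_mass hI hI' hr hrpos hadm1 ht).derivWithin
    (uniqueDiffOn_of_ordConnected hI hI' t ht),
    setIntegral_congr_fun Metric.isClosed_closedBall.measurableSet hdiv, setIntegral_const,
    Measure.addHaar_real_closedBall _ _ hrt.le, finrank_euclideanSpace, Fintype.card_fin,
    sphereArea_eq d hrt, smul_eq_mul]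
  have hpow : r t ^ d = r t ^ (d - 1) * r t := by
    rw [← pow_succ, Nat.sub_add_cancel (by omega)]
  have h1ε : 0 < 1 - ε := by linarith
  have hq0 : 0 < q := by positivity
  rw [show volume.real (Metric.ball (0 : E d) 1) = (volume (Metric.ball (0 : E d) 1)).toReal
    from rfl]
  set V := (volume (Metric.ball (0 : E d) 1)).toReal with hV
  have hV0 : 0 ≤ V := ENNReal.toReal_nonneg
  have habs : |r t ^ d * V * (d * ((1 - ε) * ρmax * (e * (|r'| + q)) / r t))| =
      ((1 - ε) * (|r'| + q)) * (ρmax * (d * V * r t ^ (d - 1))) := by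
    have : r t ^ d * V * (d * ((1 - ε) * ρmax * (e * (|r'| + q)) / r t)) =
        e * (((1 - ε) * (|r'| + q)) * (ρmax * (d * V * r t ^ (d - 1)))) := by
      rw [hpow]
      field_simp
    rw [this, abs_mul, he, one_mul, abs_of_nonneg (by positivity)]
  rw [habs]
  have hfac : (1 - 3 * ε) * (c + |r'|) ≤ (1 - ε) * (|r'| + q) := by
    have h1 : (1 - 3 * ε) * |r'| ≤ (1 - ε) * |r'| := by
      gcongr; linarith
    have h2 : (1 - 3 * ε) * c ≤ (1 - ε) * q := by
      rw [hq, ← mul_div_assoc, le_div_iff₀ (by positivity)]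
      nlinarith [mul_pos hc (mul_pos hε hε)]
    linarith
  calc (1 - 3 * ε) * (ρmax * (c + |r'|) * (d * V * r t ^ (d - 1))) =
        ((1 - 3 * ε) * (c + |r'|)) * (ρmax * (d * V * r t ^ (d - 1))) := by ring
    _ ≤ _ := by gcongr

/-- Settles `ρmax = 0`, where the construction above, which divides by the density, is unavailable.
-/
theorem isAdmissible_zero {d : ℕ} {I : Set ℝ} {c : ℝ} {v₀ : E d} (hv₀ : ‖v₀‖ = c) :
    IsAdmissible ∞ I c 0 (fun (_ : E d) _ => (0 : ℝ)) (fun _ _ => v₀) where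
  contDiffOn_density := contDiffOn_const
  contDiffOn_velocity := contDiffOn_const
  nonneg _ _ _ := le_rfl
  continuity_eq t _ x := by simp [divergence]
  density_le t _ := (eLpNorm_top_eq continuous_const (by simp) (x₀ := 0) (by simp)).le
  velocity_le t _ := (eLpNorm_top_eq continuous_const (fun _ => hv₀.le) (x₀ := 0) hv₀).le

theorem achievability {d : ℕ} (hd : 2 ≤ d) {I : Set ℝ} (hI : I.OrdConnected)
    (hI' : I.Nontrivial) {c ρmax : ℝ} (hc : 0 < c) (hρmax : 0 ≤ ρmax)
    {r : ℝ → ℝ} (hr : ContDiffOn ℝ 1 r I) (hrpos : ∀ t ∈ I, 0 < r t)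
    {ε : ℝ} (hε : 0 < ε) {t : ℝ} (ht : t ∈ I) :
    ∃ (ρ : E d → ℝ → ℝ) (v : E d → ℝ → E d), IsAdmissible ∞ I c ρmax ρ v ∧
      (∀ s ∈ I, eLpNorm (fun x => ρ x s) ⊤ volume = ENNReal.ofReal ρmax) ∧
      (∀ s ∈ I, eLpNorm (fun x => v x s) ⊤ volume = ENNReal.ofReal c) ∧
      (1 - ε) * (ρmax * (c + |derivWithin r I t|) * sphereArea d (r t))
        ≤ |derivWithin (mass r ρ) I t| := by
  rcases hρmax.eq_or_lt with rfl | hρ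
  · have hv₀ : ‖(c • EuclideanSpace.single ⟨0, by omega⟩ (1 : ℝ) : E d)‖ = c := by
      simp [norm_smul, abs_of_pos hc]
    refine ⟨_, _, isAdmissible_zero hv₀, fun s _ => ?_, fun s _ => ?_, by simp⟩
    · exact eLpNorm_top_eq continuous_const (by simp) (x₀ := 0) (by simp)
    · exact eLpNorm_top_eq continuous_const (fun _ => hv₀.le) (x₀ := 0) hv₀
  · obtain ⟨ρ, v, h1, h2, h3, h4⟩ := exists_isAdmissible_rate_ge hd hI hI' hc hρ hr hrpos
      (ε := min (ε / 3) (1 / 2)) (by positivity) ((min_le_right _ _).trans_lt (by norm_num)) ht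
    refine ⟨ρ, v, h1, h2, h3, le_trans ?_ h4⟩
    have hA : 0 ≤ sphereArea d (r t) := ENNReal.toReal_nonneg
    have : min (ε / 3) (1 / 2) ≤ ε / 3 := min_le_left _ _
    gcongr
    linarith

/-! ### Self-similar flows: a constant density pulled back by a radial map -/

section SelfSimilar

/-- The Jacobian factor `1 + G + 2wG'` of the radial map `x ↦ (1 + G(‖x‖²)) x`. -/
def radialJacobian (G : ℝ → ℝ) (w : ℝ) : ℝ := 1 + G w + 2 * w * deriv G w

/-- The self-similar density with profile `G` and length scale `T`. -/
def selfSimilarDensity (d : ℕ) (κ : ℝ) (G T : ℝ → ℝ) (x : E d) (t : ℝ) : ℝ :=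
  κ * (1 + G (‖x‖ ^ 2 / T t ^ 2)) ^ (d - 1) * radialJacobian G (‖x‖ ^ 2 / T t ^ 2)

/-- The velocity field that transports the self-similar density. -/
def selfSimilarVelocity (d : ℕ) (G T : ℝ → ℝ) (x : E d) (t : ℝ) : E d :=
  (deriv T t / T t * (2 * (‖x‖ ^ 2 / T t ^ 2) * deriv G (‖x‖ ^ 2 / T t ^ 2)
    / radialJacobian G (‖x‖ ^ 2 / T t ^ 2))) • x

variable {d : ℕ} {κ : ℝ} {G T : ℝ → ℝ}

theorem contDiff_deriv_of_contDiff (hG : ContDiff ℝ ∞ G) : ContDiff ℝ ∞ (deriv G) :=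
  (contDiff_infty_iff_deriv.1 hG).2

theorem contDiff_radialJacobian (hG : ContDiff ℝ ∞ G) : ContDiff ℝ ∞ (radialJacobian G) := by
  have := contDiff_deriv_of_contDiff hG
  unfold radialJacobian
  fun_prop

theorem contDiff_norm_sq_div_sq (hT : ContDiff ℝ ∞ T) (hT0 : ∀ t, 0 < T t) :
    ContDiff ℝ ∞ fun p : E d × ℝ => ‖p.1‖ ^ 2 / T p.2 ^ 2 :=
  (contDiff_fst.norm_sq ℝ).div ((hT.comp contDiff_snd).pow 2) fun _ => (pow_pos (hT0 _) 2).ne'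

theorem contDiff_selfSimilarDensity (hG : ContDiff ℝ ∞ G) (hT : ContDiff ℝ ∞ T)
    (hT0 : ∀ t, 0 < T t) :
    ContDiff ℝ ∞ fun p : E d × ℝ => selfSimilarDensity d κ G T p.1 p.2 := by
  have hw : ContDiff ℝ ∞ fun p : E d × ℝ => ‖p.1‖ ^ 2 / T p.2 ^ 2 := contDiff_norm_sq_div_sq hT hT0
  exact (contDiff_const.mul ((contDiff_const.add (hG.comp hw)).pow _)).mul
    ((contDiff_radialJacobian hG).comp hw)

theorem contDiff_selfSimilarVelocity (hG : ContDiff ℝ ∞ G) (hT : ContDiff ℝ ∞ T)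
    (hT0 : ∀ t, 0 < T t) (hJ : ∀ w, radialJacobian G w ≠ 0) :
    ContDiff ℝ ∞ fun p : E d × ℝ => selfSimilarVelocity d G T p.1 p.2 := by
  have hw : ContDiff ℝ ∞ fun p : E d × ℝ => ‖p.1‖ ^ 2 / T p.2 ^ 2 := contDiff_norm_sq_div_sq hT hT0
  have h1 : ContDiff ℝ ∞ fun p : E d × ℝ => deriv T p.2 / T p.2 :=
    ((contDiff_deriv_of_contDiff hT).comp contDiff_snd).div (hT.comp contDiff_snd)
      fun _ => (hT0 _).ne'
  have h2 : ContDiff ℝ ∞ fun p : E d × ℝ => deriv G (‖p.1‖ ^ 2 / T p.2 ^ 2) :=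
    (contDiff_deriv_of_contDiff hG).comp hw
  have h3 : ContDiff ℝ ∞ fun p : E d × ℝ => radialJacobian G (‖p.1‖ ^ 2 / T p.2 ^ 2) :=
    (contDiff_radialJacobian hG).comp hw
  exact ContDiff.smul (h1.mul (((contDiff_const.mul hw).mul h2).div h3 fun _ => hJ _)) contDiff_fst

/-- The density is `μ(w) + κ (1 + G(w))^d` and the flux `(T'/T) μ(w) x`, where `w = ‖x‖²/T²` and
`∂ₜw = -2w T'/T`. Then `∂ₜ μ(w)` cancels the gradient part of the divergence, and the time
derivative of the second summand cancels `d (T'/T) μ`. -/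
theorem selfSimilar_continuity_eq (hd : 0 < d) (hG : ContDiff ℝ ∞ G) (hT : ContDiff ℝ ∞ T)
    (hT0 : ∀ t, 0 < T t) (hJ : ∀ w, radialJacobian G w ≠ 0) (x : E d) (t : ℝ) :
    deriv (fun s => selfSimilarDensity d κ G T x s) t +
      divergence (fun y => selfSimilarDensity d κ G T y t • selfSimilarVelocity d G T y t) x
        = 0 := by
  set μ : ℝ → ℝ := fun w => κ * (1 + G w) ^ (d - 1) * (2 * w * deriv G w) with hμ
  have hGd := hG.differentiable (by simp)
  have hμd : Differentiable ℝ μ := by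
    have := (contDiff_deriv_of_contDiff hG).differentiable (by simp)
    fun_prop
  have hTt := (hT0 t).ne'
  have hTd := (hT.differentiable (by simp) t).hasDerivAt
  set w : ℝ := ‖x‖ ^ 2 / T t ^ 2 with hw
  have hdens : (fun s => selfSimilarDensity d κ G T x s) = fun s =>
      μ (‖x‖ ^ 2 / T s ^ 2) + κ * (1 + G (‖x‖ ^ 2 / T s ^ 2)) ^ d := by
    funext s
    obtain ⟨n, rfl⟩ := Nat.exists_eq_succ_of_ne_zero hd.ne'
    simp only [selfSimilarDensity, radialJacobian, hμ, Nat.succ_eq_add_one, Nat.add_sub_cancel]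
    ring
  have hflux : (fun y => selfSimilarDensity d κ G T y t • selfSimilarVelocity d G T y t) =
      fun y => (deriv T t / T t * μ (‖y‖ ^ 2 / T t ^ 2)) • y := by
    funext y
    simp only [selfSimilarDensity, selfSimilarVelocity, smul_smul, hμ]
    congr 1
    have := hJ (‖y‖ ^ 2 / T t ^ 2)
    field_simp
  have hwt : HasDerivAt (fun s => ‖x‖ ^ 2 / T s ^ 2) (-2 * w * (deriv T t / T t)) t := by
    refine ((hasDerivAt_const t (‖x‖ ^ 2)).fun_div (hTd.fun_pow 2)
      (pow_ne_zero 2 hTt)).congr_deriv ?_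
    rw [hw]
    field_simp
    ring
  have hwx : HasFDerivAt (fun y : E d => ‖y‖ ^ 2 / T t ^ 2)
      ((T t ^ 2)⁻¹ • (2 • innerSL ℝ x : E d →L[ℝ] ℝ)) x := by
    simpa only [div_eq_mul_inv] using
      (hasStrictFDerivAt_norm_sq x).hasFDerivAt.mul_const ((T t ^ 2)⁻¹)
  have hμt := (hμd w).hasDerivAt.comp t hwt
  have hGt := (((hGd w).hasDerivAt.comp t hwt).const_add 1).fun_pow d |>.const_mul κ
  have hμx := ((hμd w).hasDerivAt.comp_hasFDerivAt x hwx).const_mul (deriv T t / T t)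
  rw [hdens, hflux]
  have e1 : deriv (fun s => μ (‖x‖ ^ 2 / T s ^ 2) + κ * (1 + G (‖x‖ ^ 2 / T s ^ 2)) ^ d) t = _ :=
    (hμt.add hGt).deriv
  have e2 : fderiv ℝ (fun y : E d => deriv T t / T t * μ (‖y‖ ^ 2 / T t ^ 2)) x = _ := hμx.fderiv
  rw [e1, divergence_smul (f := fun y : E d => deriv T t / T t * μ (‖y‖ ^ 2 / T t ^ 2))
    hμx.differentiableAt differentiableAt_fun_id, e2]
  have e3 : divergence (fun y : E d => y) x = d := by
    simpa using divergence_const_smul_id (1 : ℝ) x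
  rw [e3]
  simp only [smul_apply, smul_eq_mul, Function.comp_apply, ← hw,
    innerSL_apply_apply, real_inner_self_eq_norm_sq, nsmul_eq_mul]
  have hxw : (T t ^ 2)⁻¹ * ((2 : ℕ) * ‖x‖ ^ 2) = 2 * w := by rw [hw]; push_cast; field_simp
  rw [hxw]
  simp only [hμ]
  ring

/-- The mass of the self-similar density in a ball. -/
theorem setIntegral_selfSimilarDensity (hd : 0 < d) (hG : ContDiff ℝ ∞ G) {R : ℝ} (hR : 0 ≤ R)
    {t : ℝ} (ht : T t ≠ 0) :
    ∫ x in Metric.closedBall (0 : E d) R, selfSimilarDensity d κ G T x t =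
      κ * (volume (Metric.ball (0 : E d) 1)).toReal * (R * (1 + G (R ^ 2 / T t ^ 2))) ^ d := by
  have : Nonempty (Fin d) := ⟨⟨0, hd⟩⟩
  have : Nontrivial (E d) := inferInstance
  have hGd := hG.differentiable (by simp)
  set p : ℝ → ℝ := fun y => κ * (1 + G (y ^ 2 / T t ^ 2)) ^ (d - 1) *
    radialJacobian G (y ^ 2 / T t ^ 2) with hp
  have hpc : Continuous p := by
    have h1 := hG.continuous
    have h2 := (contDiff_radialJacobian hG).continuous
    fun_prop
  have hind : ∫ x in Metric.closedBall (0 : E d) R, selfSimilarDensity d κ G T x t =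
      ∫ x : E d, (Iic R).indicator p ‖x‖ := by
    rw [← integral_indicator Metric.isClosed_closedBall.measurableSet]
    congr 1
    funext x
    by_cases hx : ‖x‖ ≤ R
    · rw [indicator_of_mem (by simpa using hx), indicator_of_mem (by simpa using hx)]
      rfl
    · rw [indicator_of_notMem (by simpa using hx), indicator_of_notMem (by simpa using hx)]
  have h1 : ∫ y in Ioi (0 : ℝ), y ^ (d - 1) • (Iic R).indicator p y =
      ∫ y in (0 : ℝ)..R, y ^ (d - 1) * p y := by
    rw [intervalIntegral.integral_of_le hR]
    refine (setIntegral_eq_of_subset_of_forall_sdiff_eq_zero (s := Ioc 0 R) (t := Ioi 0)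
      measurableSet_Ioi (fun _ hx => hx.1) fun y hy => ?_).trans
      (setIntegral_congr_fun measurableSet_Ioc fun y hy => ?_)
    · rw [indicator_of_notMem (show y ∉ Iic R from fun h => hy.2 ⟨hy.1, h⟩), smul_zero]
    · simp only [indicator_of_mem (show y ∈ Iic R from hy.2), smul_eq_mul]
  -- The radial integrand is an exact derivative, because `radialJacobian` is the derivative of `y
  -- (1 + G(y²/T²))`.
  have h2 : ∫ y in (0 : ℝ)..R, y ^ (d - 1) * p y =
      κ * (R * (1 + G (R ^ 2 / T t ^ 2))) ^ d / d := by
    have hd0 : (d : ℝ) ≠ 0 := by positivity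
    rw [intervalIntegral.integral_eq_sub_of_hasDerivAt
      (f := fun y => κ * (y * (1 + G (y ^ 2 / T t ^ 2))) ^ d / d) (fun y _ => ?_)
      ((by fun_prop : Continuous fun y => y ^ (d - 1) * p y).intervalIntegrable _ _)]
    · simp [hd.ne']
    · have hw : HasDerivAt (fun y : ℝ => y ^ 2 / T t ^ 2) (2 * y / T t ^ 2) y := by
        simpa using ((hasDerivAt_id y).fun_pow 2).div_const (T t ^ 2)
      have hg := ((hGd _).hasDerivAt (x := y ^ 2 / T t ^ 2)).comp y hw
      have := (((hasDerivAt_id y).fun_mul (hg.const_add 1)).fun_pow d |>.const_mul κ).div_const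
        (d : ℝ)
      refine this.congr_deriv ?_
      simp only [hp, radialJacobian, Function.comp_apply, id]
      rw [mul_pow]
      field_simp
  have hmain := integral_fun_norm_addHaar (volume : Measure (E d)) ((Iic R).indicator p)
  rw [finrank_euclideanSpace, Fintype.card_fin] at hmain
  rw [hind, hmain, h1, h2, nsmul_eq_mul, smul_eq_mul]
  change (d : ℝ) * ((volume (Metric.ball (0 : E d) 1)).toReal * _) = _
  field_simp

end SelfSimilar

/-! ### The inward profile and order-optimality -/

/-- A profile whose self-similar flow moves inward with speed `c'` outside radius `α`. -/
theorem exists_selfSimilar_profile {c c' α : ℝ} (hc' : 0 < c') (hcc : c' ≤ c) (hα : 0 < α)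
    (hαc : α ≤ c) :
    ∃ (G : ℝ → ℝ) (K : ℝ), ContDiff ℝ ∞ G ∧ (∀ w, 0 ≤ G w) ∧ (∀ w, G w ≤ K) ∧
      (∀ w, 1 ≤ radialJacobian G w) ∧ (∀ w, radialJacobian G w ≤ K) ∧
      (∀ w, |√w * (2 * w * deriv G w)| ≤ c * radialJacobian G w) ∧
      ∀ w, α ^ 2 ≤ w → √w * G w = c' := by
  set w₀ : ℝ := α ^ 2 / 4 with hw₀
  have hw₀0 : 0 < w₀ := by positivity
  have hgap : 0 < α ^ 2 - w₀ := by rw [hw₀]; nlinarith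
  set χ : ℝ → ℝ := fun w => Real.smoothTransition ((w - w₀) / (α ^ 2 - w₀)) with hχ
  have hχC : ContDiff ℝ ∞ χ := Real.smoothTransition.contDiff.comp (by fun_prop)
  have hχd := hχC.differentiable (by simp)
  have hχ0 : ∀ w, 0 ≤ χ w := fun w => Real.smoothTransition.nonneg _
  have hχ1 : ∀ w, χ w ≤ 1 := fun w => Real.smoothTransition.le_one _
  have hχlow : ∀ w ≤ w₀, χ w = 0 := fun w hw =>
    Real.smoothTransition.zero_of_nonpos (div_nonpos_of_nonpos_of_nonneg (by linarith) hgap.le)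
  have hχhigh : ∀ w, α ^ 2 ≤ w → χ w = 1 := fun w hw =>
    Real.smoothTransition.one_of_one_le ((one_le_div hgap).2 (by linarith))
  have hχ'0 : ∀ w, 0 ≤ deriv χ w := fun w => by
    refine Monotone.deriv_nonneg fun x y hxy => Real.smoothTransition.monotone ?_
    gcongr
  have hχ'high : ∀ w, α ^ 2 ≤ w → deriv χ w = 0 := fun w hw => by
    refine IsLocalMax.deriv_eq_zero (Eventually.of_forall fun z => ?_)
    rw [hχhigh w hw]
    exact hχ1 z
  -- The cutoff removes the singularity of `c' / √w` at the origin. Since `G + 2wG'` annihilates `1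
  -- / √w`, only `χ'` contributes to the Jacobian beyond `1`.
  set G : ℝ → ℝ := fun w => c' * χ w / √w with hG
  have hGlow : ∀ w < w₀, G =ᶠ[𝓝 w] fun _ => 0 := fun w hw => by
    filter_upwards [Iio_mem_nhds hw] with z hz
    simp [hG, hχlow z (le_of_lt hz)]
  have hGC : ContDiff ℝ ∞ G := by
    rw [contDiff_iff_contDiffAt]
    intro w
    rcases lt_or_ge w w₀ with hw | hw
    · exact contDiffAt_const.congr_of_eventuallyEq (hGlow w hw)
    · have hw0 : 0 < w := hw₀0.trans_le hw
      exact (contDiff_const.mul hχC).contDiffAt.div (Real.contDiffAt_sqrt hw0.ne')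
        (Real.sqrt_pos.2 hw0).ne'
  have hJlow : ∀ w < w₀, deriv G w = 0 ∧ radialJacobian G w = 1 := fun w hw => by
    have h1 : deriv G w = 0 := by simp [(hGlow w hw).deriv_eq]
    exact ⟨h1, by simp [radialJacobian, h1, (hGlow w hw).eq_of_nhds]⟩
  have hG' : ∀ w, w₀ ≤ w → √w * (2 * w * deriv G w) = c' * (2 * w * deriv χ w - χ w) ∧
      radialJacobian G w = 1 + 2 * c' * √w * deriv χ w := fun w hw => by
    have hw0 : 0 < w := hw₀0.trans_le hw
    have hs : 0 < √w := Real.sqrt_pos.2 hw0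
    have hsq : √w ^ 2 = w := Real.sq_sqrt hw0.le
    have h1 : deriv G w = (c' * deriv χ w * √w - c' * χ w * (1 / (2 * √w))) / √w ^ 2 :=
      (((hχd w).hasDerivAt.const_mul c').fun_div (Real.hasDerivAt_sqrt hw0.ne') hs.ne').deriv
    constructor
    · rw [h1, hsq]
      field_simp
      rw [hsq]
      ring
    · simp only [radialJacobian]
      rw [h1, hsq]
      simp only [hG]
      field_simp
      ring
  have hJ1 : ∀ w, 1 ≤ radialJacobian G w := fun w => by
    rcases lt_or_ge w w₀ with hw | hw
    · exact (hJlow w hw).2.ge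
    · rw [(hG' w hw).2]
      have := hχ'0 w
      have : 0 ≤ 2 * c' * √w * deriv χ w := by positivity
      linarith
  have hJcs : HasCompactSupport fun w => radialJacobian G w - 1 := by
    refine HasCompactSupport.intro (isCompact_Icc (a := w₀) (b := α ^ 2)) fun w hw => ?_
    rcases lt_or_ge w w₀ with h | h
    · rw [(hJlow w h).2, sub_self]
    · have h2 : α ^ 2 ≤ w := by
        by_contra hlt
        exact hw ⟨h, (not_le.1 hlt).le⟩
      rw [(hG' w h).2, hχ'high w h2]
      ring
  obtain ⟨K₁, hK₁⟩ := hJcs.exists_bound_of_continuous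
    ((contDiff_radialJacobian hGC).continuous.sub continuous_const)
  have hG0 : ∀ w, 0 ≤ G w := fun w => by
    have := hχ0 w
    positivity
  refine ⟨G, max (c' / √w₀) (1 + K₁), hGC, hG0, fun w => ?_, hJ1, fun w => ?_, fun w => ?_,
    fun w hw => ?_⟩
  · rcases lt_or_ge w w₀ with hw | hw
    · rw [(hGlow w hw).eq_of_nhds]
      exact le_max_of_le_left (by positivity)
    · refine le_max_of_le_left ?_
      have hs : 0 < √w₀ := Real.sqrt_pos.2 hw₀0
      exact div_le_div₀ hc'.le (mul_le_of_le_one_right hc'.le (hχ1 w)) hs (Real.sqrt_le_sqrt hw)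
  · have := (le_abs_self _).trans (hK₁ w)
    exact le_max_of_le_right (by linarith)
  · rcases lt_or_ge w w₀ with hw | hw
    · rw [(hJlow w hw).1, (hJlow w hw).2]
      simpa using hc'.le.trans hcc
    · have hw0 : 0 < w := hw₀0.trans_le hw
      have hD := hχ'0 w
      have hX0 := hχ0 w
      have hX1 := hχ1 w
      rw [(hG' w hw).1, (hG' w hw).2, abs_le]
      have hpos : 0 ≤ 2 * c' * √w * deriv χ w := by positivity
      constructor
      · have h1 : 0 ≤ c' * (2 * w * deriv χ w) := by positivity
        have h2 : c' * χ w ≤ c' := mul_le_of_le_one_right hc'.le hX1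
        have h3 : 0 ≤ c * (2 * c' * √w * deriv χ w) := mul_nonneg (hc'.le.trans hcc) hpos
        nlinarith
      -- Where `χ' ≠ 0` one has `√w ≤ α ≤ c`; this is why `α` may not exceed `c`.
      · have h1 : c' * (2 * w * deriv χ w) ≤ c * (2 * c' * √w * deriv χ w) := by
          rcases le_or_gt (α ^ 2) w with h | h
          · simp [hχ'high w h]
          · have hsw : √w ≤ c := (Real.sqrt_le_left hα.le).2 h.le |>.trans hαc
            calc c' * (2 * w * deriv χ w) = √w * (2 * c' * √w * deriv χ w) := by
                  have := Real.sq_sqrt hw0.le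
                  linear_combination (-2 * c' * deriv χ w) * this
              _ ≤ _ := by gcongr
        have h2 : 0 ≤ c' * χ w := by positivity
        linarith [hc'.trans_le hcc]
  · have hw0 : 0 < w := (by positivity : 0 < α ^ 2).trans_le hw
    simp only [hG, hχhigh w hw]
    field_simp

theorem hasDerivAt_sqrt_one_add_sq (t : ℝ) :
    HasDerivAt (fun t : ℝ => √(1 + t ^ 2)) (t / √(1 + t ^ 2)) t := by
  have h1 : HasDerivAt (fun t : ℝ => 1 + t ^ 2) (2 * t) t := by
    simpa using ((hasDerivAt_id t).fun_pow 2).const_add 1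
  refine (h1.sqrt (by positivity)).congr_deriv ?_
  field_simp

/-- The upper order is the general growth bound; only the lower one uses the explicit mass. -/
theorem order_optimality {d : ℕ} (hd : 0 < d) {I : Set ℝ} (hI : I.OrdConnected)
    (hI' : I.Nontrivial) {c ρmax : ℝ} (hc : 0 < c) (hρmax : 0 < ρmax)
    {r : ℝ → ℝ} (hr : ContDiffOn ℝ 1 r I) (hrpos : ∀ t ∈ I, 0 < r t)
    (hr' : ∀ t ∈ I, |derivWithin r I t| ≤ c) (hub : ¬ BddAbove I)
    (hrΘ : r =Θ[atTop] (fun t : ℝ => t)) {b : ℝ} (hb : -c < b)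
    (hrb : ∀ᶠ t in atTop, b ≤ derivWithin r I t) :
    ∃ (ρ : E d → ℝ → ℝ) (v : E d → ℝ → E d), IsAdmissible ∞ I c ρmax ρ v ∧
      derivWithin (mass r ρ) I =Θ[atTop] (fun t : ℝ => t ^ (d - 1)) := by
  have hu := uniqueDiffOn_of_ordConnected hI hI'
  -- `c'` is the limiting inward speed; `c'' < c'` leaves room for `T'` being only close to `1`, and
  -- `b + c'' > 0`.
  obtain ⟨c', hbc', hc'c⟩ := exists_between (max_lt (by linarith : -b < c) hc)
  obtain ⟨c'', hbc'', hc''c'⟩ := exists_between hbc'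
  have hc'0 : 0 < c' := (le_max_right _ _).trans_lt hbc'
  have hc''0 : 0 < c'' := (le_max_right _ _).trans_lt hbc''
  have hbc : 0 < b + c'' := by linarith [(le_max_left (-b) 0).trans_lt hbc'']
  obtain ⟨C, hC, hCr⟩ := hrΘ.2.exists_pos
  -- Eventually `t ≤ C r` and `T ≤ 2t`, hence `r / T ≥ 1 / (2C)`: the boundary lies where the
  -- profile is explicit.
  set α : ℝ := min ((2 * C)⁻¹) c with hα
  have hα0 : 0 < α := by positivity
  obtain ⟨G, K, hG, hG0, hGK, hJ1, hJK, hvel, hout⟩ :=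
    exists_selfSimilar_profile hc'0 hc'c.le hα0 (min_le_right _ _)
  have hJ0 : ∀ w, 0 < radialJacobian G w := fun w => one_pos.trans_le (hJ1 w)
  have hK1 : 1 ≤ K := (hJ1 0).trans (hJK 0)
  -- Normalised so that the bounds `G ≤ K` and Jacobian `≤ K` give density at most `ρmax`.
  set κ : ℝ := ρmax / ((1 + K) ^ (d - 1) * K) with hκ
  have hκ0 : 0 < κ := by positivity
  set T : ℝ → ℝ := fun t => √(1 + t ^ 2) with hT
  have hT0 : ∀ t, 0 < T t := fun t => Real.sqrt_pos.2 (by positivity)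
  have hTC : ContDiff ℝ ∞ T := ContDiff.sqrt (by fun_prop) fun t => by positivity
  have hT' : ∀ t, deriv T t = t / T t := fun t => (hasDerivAt_sqrt_one_add_sq t).deriv
  have hT'1 : ∀ t, |deriv T t| ≤ 1 := fun t => by
    rw [hT', abs_div, abs_of_pos (hT0 t), div_le_one (hT0 t)]
    exact Real.abs_le_sqrt (by linarith)
  set ρ := selfSimilarDensity d κ G T with hρ
  set v := selfSimilarVelocity d G T with hv
  have hρC : ContDiff ℝ ∞ fun p : E d × ℝ => ρ p.1 p.2 := contDiff_selfSimilarDensity hG hTC hT0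
  have hvC : ContDiff ℝ ∞ fun p : E d × ℝ => v p.1 p.2 :=
    contDiff_selfSimilarVelocity hG hTC hT0 fun w => (hJ0 w).ne'
  have hρ0 : ∀ x t, 0 ≤ ρ x t := fun x t =>
    mul_nonneg (mul_nonneg hκ0.le (pow_nonneg (add_nonneg zero_le_one (hG0 _)) _)) (hJ0 _).le
  have hρle : ∀ x t, ρ x t ≤ ρmax := fun x t => by
    have h1 := hG0 (‖x‖ ^ 2 / T t ^ 2)
    have h2 := hGK (‖x‖ ^ 2 / T t ^ 2)
    have h3 := hJK (‖x‖ ^ 2 / T t ^ 2)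
    have h4 := (hJ0 (‖x‖ ^ 2 / T t ^ 2)).le
    calc ρ x t ≤ κ * (1 + K) ^ (d - 1) * K := by
          simp only [hρ, selfSimilarDensity]
          gcongr
      _ = ρmax := by
          rw [hκ]
          field_simp
  have hvle : ∀ x t, ‖v x t‖ ≤ c := fun x t => by
    set w := ‖x‖ ^ 2 / T t ^ 2 with hw
    have hsw : √w = ‖x‖ / T t := by
      rw [hw, ← div_pow, Real.sqrt_sq (div_nonneg (norm_nonneg _) (hT0 t).le)]
    have h1 : ‖v x t‖ = |deriv T t| * (|√w * (2 * w * deriv G w)| / radialJacobian G w) := by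
      simp only [hv, selfSimilarVelocity, norm_smul, Real.norm_eq_abs, ← hw]
      rw [hsw]
      simp only [abs_mul, abs_div, abs_of_pos (hT0 t), abs_of_pos (hJ0 w), abs_norm]
      ring
    rw [h1]
    calc |deriv T t| * (|√w * (2 * w * deriv G w)| / radialJacobian G w) ≤ 1 * c := by
          have h2 : |√w * (2 * w * deriv G w)| / radialJacobian G w ≤ c :=
            (div_le_iff₀ (hJ0 w)).2 (hvel w)
          have h3 := hT'1 t
          gcongr
          exact div_nonneg (abs_nonneg _) (hJ0 w).le
      _ = c := one_mul c
  have hadm : ∀ k : WithTop ℕ∞, k ≤ ∞ → IsAdmissible k I c ρmax ρ v := fun k hk =>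
    { contDiffOn_density := (hρC.of_le hk).contDiffOn
      contDiffOn_velocity := (hvC.of_le hk).contDiffOn
      nonneg := fun t _ x => hρ0 x t
      continuity_eq := fun t ht x => by
        have hdiff : DifferentiableAt ℝ (fun s => ρ x s) t :=
          ((hρC.differentiable (by simp)).comp
            (by fun_prop : Differentiable ℝ fun s : ℝ => (x, s))) t
        rw [hdiff.derivWithin (hu t ht)]
        exact selfSimilar_continuity_eq hd hG hTC hT0 (fun w => (hJ0 w).ne') x t
      density_le := fun t ht => by
        refine (eLpNorm_top_le_iff (contDiff_slice (I := univ) hρC.contDiffOn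
          (mem_univ t)).continuous hρmax.le).2 fun x => ?_
        rw [Real.norm_eq_abs, abs_of_nonneg (hρ0 x t)]
        exact hρle x t
      velocity_le := fun t ht => (eLpNorm_top_le_iff (contDiff_slice (I := univ) hvC.contDiffOn
          (mem_univ t)).continuous hc.le).2 fun x => hvle x t }
  refine ⟨ρ, v, hadm ∞ le_rfl, derivWithin_mass_isBigO hd hI hI' hc.le hρmax.le hr hrpos hr'
    (hadm 1 (by simp)) hub hrΘ.1, ?_⟩
  refine (hrΘ.2.pow (d - 1)).trans ?_
  obtain ⟨a, haI⟩ := exists_Ici_subset_of_not_bddAbove hI hub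
  set V := (volume (Metric.ball (0 : E d) 1)).toReal with hV
  have hV0 : 0 < V := ENNReal.toReal_pos (Metric.measure_ball_pos _ _ one_pos).ne'
    measure_ball_lt_top.ne
  -- outside radius `α T` the mass is explicit
  have hrT : ∀ᶠ s in atTop, s ∈ I ∧ mass r ρ s = κ * V * (r s + c' * T s) ^ d := by
    filter_upwards [eventually_ge_atTop a, eventually_ge_atTop 1, hCr.bound] with s hsa hs1 hs
    have hsI := haI hsa
    have hrs := hrpos s hsI
    refine ⟨hsI, ?_⟩
    rw [Real.norm_eq_abs, Real.norm_eq_abs, abs_of_pos hrs, abs_of_pos (by linarith)] at hs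
    have hTs : T s ≤ 2 * s := Real.sqrt_le_iff.2 ⟨by linarith, by nlinarith⟩
    have hαT : α ≤ r s / T s := by
      rw [le_div_iff₀ (hT0 s)]
      calc α * T s ≤ (2 * C)⁻¹ * (2 * s) := by
            gcongr
            exact min_le_left _ _
        _ = C⁻¹ * s := by field_simp
        _ ≤ C⁻¹ * (C * r s) := by gcongr
        _ = r s := by field_simp
    have hm : mass r ρ s = _ := setIntegral_selfSimilarDensity (κ := κ) hd hG hrs.le (hT0 s).ne'
    have hout' := hout (r s ^ 2 / T s ^ 2) (by rw [← div_pow]; gcongr)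
    rw [← div_pow, Real.sqrt_sq (div_nonneg hrs.le (hT0 s).le), div_pow] at hout'
    have hTs0 := (hT0 s).ne'
    have hlin : r s * (1 + G (r s ^ 2 / T s ^ 2)) = r s + c' * T s := by
      rw [← hout']
      field_simp
    rw [hm, hlin]
  obtain ⟨t₁, ht₁⟩ := eventually_atTop.1 hrT
  refine IsBigO.of_bound (κ * V * d * (b + c''))⁻¹ ?_
  filter_upwards [eventually_gt_atTop t₁, hrb, eventually_ge_atTop (c'' / (c' - c'')),
    eventually_ge_atTop 0] with t htt hbt htc ht0
  have htI := (ht₁ t htt.le).1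
  have hrt := hrpos t htI
  have hmass : mass r ρ =ᶠ[𝓝[I] t] fun s => κ * V * (r s + c' * T s) ^ d := by
    filter_upwards [mem_nhdsWithin_of_mem_nhds (Ioi_mem_nhds htt)] with s hs
    exact (ht₁ s (le_of_lt hs)).2
  have hdr : HasDerivWithinAt r (derivWithin r I t) I t :=
    (hr.differentiableOn one_ne_zero t htI).hasDerivWithinAt
  have hdT : HasDerivWithinAt T (deriv T t) I t :=
    (hTC.differentiable (by simp) t).hasDerivAt.hasDerivWithinAt
  have hderiv := (((hdr.fun_add (hdT.const_mul c')).fun_pow d).const_mul (κ * V)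
    ).congr_of_eventuallyEq_of_mem hmass htI
  rw [hderiv.derivWithin (hu t htI)]
  have hTt := hT0 t
  have hTle : T t ≤ t + 1 := Real.sqrt_le_iff.2 ⟨by linarith, by nlinarith⟩
  -- As `T ≤ t + 1`, it suffices that `c'' (t + 1) ≤ c' t`, which is the threshold on `t` above.
  have hcT : c'' ≤ c' * deriv T t := by
    rw [hT', ← mul_div_assoc, le_div_iff₀ hTt]
    rw [div_le_iff₀ (by linarith)] at htc
    nlinarith
  have hlow : b + c'' ≤ derivWithin r I t + c' * deriv T t := add_le_add hbt hcT
  rw [Real.norm_eq_abs, Real.norm_eq_abs, abs_of_nonneg (pow_nonneg hrt.le _),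
    inv_mul_eq_div, le_div_iff₀ (by positivity)]
  refine le_trans ?_ (le_abs_self _)
  calc r t ^ (d - 1) * (κ * V * d * (b + c'')) = κ * V * (d * r t ^ (d - 1) * (b + c'')) := by ring
    _ ≤ _ := by
      gcongr
      have : 0 ≤ c' * T t := by positivity
      linarith

end MovingBall

end
open MovingBall in
theorem mainTheorem9 (d : ℕ) (hd : 2 ≤ d)
    (I : Set ℝ) (hI : I.OrdConnected) (hI' : I.Nontrivial)
    (c ρmax : ℝ) (hc : 0 < c) (hρmax : 0 ≤ ρmax)
    (r : ℝ → ℝ) (hr : ContDiffOn ℝ 1 r I) (hrpos : ∀ t ∈ I, 0 < r t)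
    (hr' : ∀ t ∈ I, |derivWithin r I t| ≤ c) :
    -- the bound on the instantaneous growth rate, and its order for `r(t) = Θ(t)`
    (∀ (ρ : E d → ℝ → ℝ) (v : E d → ℝ → E d), IsAdmissible 1 I c ρmax ρ v →
      (∀ t ∈ I, DifferentiableWithinAt ℝ (mass r ρ) I t ∧
        |derivWithin (mass r ρ) I t|
          ≤ ρmax * (c + |derivWithin r I t|) * sphereArea d (r t)) ∧
      (¬ BddAbove I → r =Θ[atTop] (fun t : ℝ => t) →
        derivWithin (mass r ρ) I =O[atTop] (fun t : ℝ => t ^ (d - 1)))) ∧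
    -- the constant is achieved at any given time up to a factor `1 - ε`
    (∀ ε : ℝ, 0 < ε → ∀ t ∈ I, ∃ (ρ : E d → ℝ → ℝ) (v : E d → ℝ → E d),
      IsAdmissible ∞ I c ρmax ρ v ∧
      (∀ s ∈ I, eLpNorm (fun x => ρ x s) ⊤ volume = ENNReal.ofReal ρmax) ∧
      (∀ s ∈ I, eLpNorm (fun x => v x s) ⊤ volume = ENNReal.ofReal c) ∧
      (1 - ε) * (ρmax * (c + |derivWithin r I t|) * sphereArea d (r t))
        ≤ |derivWithin (mass r ρ) I t|) ∧
    -- the order `t ^ (d - 1)` is optimal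
    (0 < ρmax → ¬ BddAbove I → r =Θ[atTop] (fun t : ℝ => t) →
      (∃ b : ℝ, -c < b ∧ ∀ᶠ t in atTop, b ≤ derivWithin r I t) →
      ∃ (ρ : E d → ℝ → ℝ) (v : E d → ℝ → E d), IsAdmissible ∞ I c ρmax ρ v ∧
        derivWithin (mass r ρ) I =Θ[atTop] (fun t : ℝ => t ^ (d - 1))) := by
  have hd0 : 0 < d := by omega
  refine ⟨fun ρ v h => ⟨fun t ht => ⟨?_, ?_⟩, fun hub hrΘ => ?_⟩, fun ε hε t ht => ?_,
    fun hρ hub hrΘ ⟨b, hb, hrb⟩ => ?_⟩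
  · exact (hasDerivWithinAt_mass hI hI' hr hrpos h ht).differentiableWithinAt
  · exact abs_derivWithin_mass_le hd0 hI hI' hc.le hρmax hr hrpos h ht
  · exact derivWithin_mass_isBigO hd0 hI hI' hc.le hρmax hr hrpos hr' h hub hrΘ.1
  · exact achievability hd hI hI' hc hρmax hr hrpos hε ht
  · exact order_optimality hd0 hI hI' hc hρ hr hrpos hr' hub hrΘ hb hrb
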